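/- For $\varphi\in L^1(\mathbb R)$ let $\widehat\varphi(x)=\int_{\mathbb R}e^{-ixt}\varphi(t)\,dt$, and let $\widehat f$ denote the Fourier transform of $f\in L^2(\mathbb R)$ in the same normalisation. Let $0<\beta<\frac13$ and $q>\frac12$. Let $\varphi_0\in L^1(\mathbb R)$ be not almost everywhere zero, let $f_0,g_0\in L^2(\mathbb R)$ satisfy $\int_{\mathbb R}f_0(t-s)\varphi_0(s)\,ds=g_0(t)$ for almost every $t$, and suppose that for some constant $C$ $$|\widehat{f_0}(\lambda)|^2\le C(1+\lambda^2)^{-q}\quad\text{for almost every }\lambda\in\mathbb R .$$ Put $p(s)=-\log\int_{|t|\ge s}|\varphi_0(t)|\,dt\in(-\infty,+\infty]$ and assume $p(s)/s\to\infty$ as $s\to\infty$. For $\epsilon>0$ put $s_\epsilon=\inf\{s>0: e^{-p(s)}\le\epsilon\}$ and $\delta_\epsilon=(C_1/C_2)^{1/4}\epsilon^{(1+3\beta)/2}$, where $C_1=4(1+\|g_0\|_{L^2}^2+\|\varphi_0\|_{L^1}^2)$ and $C_2=1+\|g_0\|_{L^2}^2$. Then for all sufficiently small $\epsilon>0$ there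 is exactly one $R_\epsilon>0$ with $$\Big[(q+\tfrac12)\log R_\epsilon+\log(15e^3)\Big]\Big[\log\|\varphi_0\|_{L^1}+2e\,s_\epsilon R_\epsilon\Big]=-\log(\epsilon^\beta+\epsilon)$$ whose first factor is positive (for $\|\varphi_0\|_{L^1}\ge1$ and small $\epsilon$ the positivity is automatic), and the following hold. (i) $R_\epsilon\to\infty$ as $\epsilon\to0^+$. (ii) There is a constant $C_3>0$, independent of $\epsilon$, such that for all sufficiently small $\epsilon>0$ and all $\varphi_\epsilon\in L^1(\mathbb R)$, $g_\epsilon\in L^2(\mathbb R)$ with $\|\varphi_0-\varphi_\epsilon\|_{L^1}\le\epsilon$ and $\|g_0-g_\epsilon\|_{L^2}\le\epsilon$, the function $f_\epsilon\in L^2(\mathbb R)$ with $$\widehat{f_\epsilon}=\frac{\widehat{g_\epsilon}\,\overline{\widehat{\varphi_\epsilon}}}{\delta_\epsilon+|\widehat{\varphi_\epsilon}|^2}$$ satisfies $\|f_0-f_\epsilon\|_{L^2}\le C_3R_\epsilon^{-q+1/2}$. (iii) If $\varphi_0$ has compact support, then $s_\epsilon$ is bounded for $\epsilon>0$ small enough,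 and $\displaystyle\lim_{\epsilon\to0^+}\frac{\log R_\epsilon}{\log\log(1/\epsilon)}=1$. -/

import Mathlib

open Filter Topology MeasureTheory FourierTransform
open scoped ENNReal

noncomputable section

namespace Deconvolution

/-- The space `L²(ℝ)` of complex valued functions, with respect to Lebesgue measure. -/
abbrev L2 : Type := Lp ℂ 2 (volume : Measure ℝ)

/-- The Fourier transform `φ̂(x) = ∫ e^{-ixt} φ(t) dt` of an integrable function. -/
def hat (φ : ℝ → ℂ) (x : ℝ) : ℂ :=
  ∫ t : ℝ, Complex.exp (-(Complex.I * x * t)) * φ t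

/-- The (Plancherel) Fourier transform of `f ∈ L²(ℝ)` in the normalisation
`f̂(x) = ∫ e^{-ixt} f(t) dt`. Mathlib's `𝓕` uses the character `e^{-2πixt}`, whence the
rescaling of the variable. The function is determined up to a null set. -/
def hat2 (f : L2) (x : ℝ) : ℂ :=
  (𝓕 f : L2) (x / (2 * Real.pi))

/-- The norm of an integrable function in `L¹(ℝ)`. -/
def norm1 (φ : ℝ → ℂ) : ℝ := ∫ t : ℝ, ‖φ t‖

/-- `p(s) = -log ∫_{|t| ≥ s} |φ(t)| dt`, with values in the extended reals
(so `p(s) = +∞` if `φ` vanishes almost everywhere on `|t| ≥ s`). -/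
def p (φ : ℝ → ℂ) (s : ℝ) : EReal :=
  -ENNReal.log (∫⁻ t in {t : ℝ | s ≤ |t|}, ‖φ t‖ₑ)

/-- `s_ε = inf {s > 0 : e^{-p(s)} ≤ ε}`. -/
def cutoff (φ : ℝ → ℂ) (ε : ℝ) : ℝ :=
  sInf {s : ℝ | 0 < s ∧ EReal.exp (-p φ s) ≤ ENNReal.ofReal ε}

/-- `f` solves the convolution equation `∫ f(t - s) φ(s) ds = g(t)`. -/
def IsSolution (φ : ℝ → ℂ) (f g : L2) : Prop :=
  ∀ᵐ t : ℝ, ∫ s : ℝ, f (t - s) * φ s = g t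

/-- `f` is the Tikhonov approximation with parameter `δ` built from the data `(φ, g)`:
the function of `L²(ℝ)` whose Fourier transform is `ĝ · conj φ̂ / (δ + |φ̂|²)`. -/
def IsTikhonov (δ : ℝ) (φ : ℝ → ℂ) (g f : L2) : Prop :=
  ∀ᵐ x : ℝ, hat2 f x =
    hat2 g x * (starRingEnd ℂ) (hat φ x) / ((δ + ‖hat φ x‖ ^ 2 : ℝ) : ℂ)

/-- `C₁ = 4 (1 + ‖g₀‖² + ‖φ₀‖²)`. -/
def C1 (φ₀ : ℝ → ℂ) (g₀ : L2) : ℝ := 4 * (1 + ‖g₀‖ ^ 2 + norm1 φ₀ ^ 2)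

/-- `C₂ = 1 + ‖g₀‖²`. -/
def C2 (g₀ : L2) : ℝ := 1 + ‖g₀‖ ^ 2

/-- The regularization parameter `δ_ε = (C₁ / C₂)^{1/4} ε^{(1 + 3β)/2}`. -/
def delta (φ₀ : ℝ → ℂ) (g₀ : L2) (β ε : ℝ) : ℝ :=
  (C1 φ₀ g₀ / C2 g₀) ^ (1 / 4 : ℝ) * ε ^ ((1 + 3 * β) / 2)

/-- `R > 0` solves
`[(q + 1/2) log R + log (15 e³)] [log ‖φ‖₁ + 2 e s_ε R] = -log (ε^β + ε)`.
The first factor is required to be positive. If `‖φ‖₁ ≥ 1` this is automatic for small `ε`; if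
`‖φ‖₁ < 1` it discards the spurious solution near `R = 0` at which both factors are negative. -/
def IsRadius (φ : ℝ → ℂ) (q β ε R : ℝ) : Prop :=
  0 < R ∧
  0 < (q + 1 / 2) * Real.log R + Real.log (15 * Real.exp 3) ∧
  ((q + 1 / 2) * Real.log R + Real.log (15 * Real.exp 3)) *
      (Real.log (norm1 φ) + 2 * Real.exp 1 * cutoff φ ε * R) = -Real.log (ε ^ β + ε)

/-- `φ` (as a class of functions modulo null sets) has compact support. -/
def HasCompactSupp (φ : ℝ → ℂ) : Prop :=
  ∃ A : ℝ, ∀ᵐ t : ℝ, A < |t| → φ t = 0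

end Deconvolution

end

/-! Write u, a, b for the transforms of f₀, φ₀, φ_ε. The convolution theorem `fourier_solution`
gives ĝ₀ = a u, and pointwise (`norm_sub_tikhonov_le`) the error is at most δ/(δ+|b|²)·|u| + (ε|u| +
|ĝ_ε - a u|)/(2√δ). The last term is O(ε/√δ) in L², and the first is O(δ ε^(-2β))|u| wherever |b| ≥
ε^β/2. For δ of order ε^((1+3β)/2) both are positive powers of ε. There remains |u| on |x| > R and
on the set E of those |x| ≤ R where the transform of φ₀ truncated to [-s_ε, s_ε] is at most ε^β + ε.
The decay of u bounds this by a multiple of R^(-q+1/2), provided |E| ≤ R^(1-2q).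

That measure bound (`volume_small_set_le`) is the heart of the matter. The truncated transform is
entire of exponential type s_ε and bounded below at a fixed point. If it were small on a large
subset of [-R, R], interpolate it at n separated points of that subset: the interpolant is small,
and the difference has n zeros, hence is small at the centre by a Blaschke argument
(`norm_apply_zero_le_of_small_on`). With n about e s_ε R this contradicts the lower bound; the
equation for R_ε is exactly what makes ε^β + ε a small enough threshold.

As for the size of R_ε: p(s)/s → ∞ makes s_ε = o(log(1/ε)), which forces R_ε → ∞. Since s_ε stays
away from 0, R_ε = O(log(1/ε)), so positive powers of ε are negligible against R_ε^(-q+1/2). When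
s_ε is also bounded above, R_ε log R_ε is comparable to log(1/ε), whence the limit of the
logarithms. -/

namespace Deconvolution

/-! ### Zeros, interpolation and a Remez type inequality -/

/-- A Blaschke product estimate: an entire function bounded by `M` on the circle of radius `ρ`
is small at the origin if it has many zeros. -/
theorem norm_apply_zero_le_of_zeros {ρ M : ℝ} (hρ : 0 < ρ) (S : Finset ℂ) :
    ∀ G : ℂ → ℂ, Differentiable ℂ G → (∀ x ∈ S, G x = 0) → (∀ x ∈ S, ‖x‖ < ρ) →
      (∀ z, ‖z‖ = ρ → ‖G z‖ ≤ M) → ‖G 0‖ ≤ M * ∏ x ∈ S, (‖x‖ / ρ) := by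
  classical
  induction S using Finset.induction_on with
  | empty =>
    intro G hG _ _ hM
    simp only [Finset.prod_empty, mul_one]
    refine Complex.norm_le_of_forall_mem_frontier_norm_le (U := Metric.ball 0 ρ)
      Metric.isBounded_ball hG.diffContOnCl ?_ (subset_closure (Metric.mem_ball_self hρ))
    intro z hz
    rw [frontier_ball _ hρ.ne'] at hz
    exact hM z (by simpa using hz)
  | insert a S ha ih =>
    intro G hG h0 hlt hM
    have hGa : G a = 0 := h0 a (Finset.mem_insert_self _ _)
    have hdiff : Differentiable ℂ (dslope G a) := by
      rw [← differentiableOn_univ]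
      exact (Complex.differentiableOn_dslope Filter.univ_mem).2 hG.differentiableOn
    have hfac : ∀ z, G z = (z - a) * dslope G a z := by
      intro z
      have := sub_smul_dslope G a z
      rw [hGa, sub_zero, smul_eq_mul] at this
      exact this.symm
    -- `H` is `G` divided by the Blaschke factor of `a`: on |z| = ρ one has |ρ² - āz| = ρ|z - a|, so
    -- |H| = |G| there, while the value at 0 gains the factor ρ/|a|.
    set H : ℂ → ℂ := fun z => dslope G a z * ((ρ ^ 2 - (starRingEnd ℂ) a * z) / ρ) with hH
    have hHd : Differentiable ℂ H := by
      rw [hH]; fun_prop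
    have hHz : ∀ x ∈ S, H x = 0 := by
      intro x hx
      have hxa : x - a ≠ 0 := by
        intro h
        rw [sub_eq_zero] at h
        exact ha (h ▸ hx)
      have h1 := hfac x
      rw [h0 x (Finset.mem_insert_of_mem hx)] at h1
      have : dslope G a x = 0 := by
        rcases mul_eq_zero.1 h1.symm with h | h
        · exact absurd h hxa
        · exact h
      simp [hH, this]
    have hHM : ∀ z, ‖z‖ = ρ → ‖H z‖ ≤ M := by
      intro z hz
      refine le_trans (le_of_eq ?_) (hM z hz)
      have hzz : (ρ : ℂ) ^ 2 = (starRingEnd ℂ) z * z := by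
        rw [mul_comm, Complex.mul_conj, Complex.normSq_eq_norm_sq, hz]
        push_cast; rfl
      have : ((ρ : ℂ) ^ 2 - (starRingEnd ℂ) a * z) = (starRingEnd ℂ) (z - a) * z := by
        rw [hzz, map_sub]; ring
      rw [hfac z, hH]
      simp only [this, norm_mul, norm_div, RCLike.norm_conj, hz, Complex.norm_real, Real.norm_eq_abs,
        abs_of_pos hρ]
      field_simp
    have key := ih H hHd hHz (fun x hx => hlt x (Finset.mem_insert_of_mem hx)) hHM
    have hH0 : ‖G 0‖ = ‖a‖ / ρ * ‖H 0‖ := by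
      rw [hfac 0, hH]
      simp only [mul_zero, sub_zero, zero_sub, norm_mul, norm_neg, norm_div, norm_pow,
        Complex.norm_real, Real.norm_eq_abs, abs_of_pos hρ]
      field_simp
    rw [Finset.prod_insert ha, hH0]
    calc ‖a‖ / ρ * ‖H 0‖ ≤ ‖a‖ / ρ * (M * ∏ x ∈ S, (‖x‖ / ρ)) := by gcongr
      _ = _ := by ring

/-- A compact set of measure more than `n d` contains `n + 1` points with gaps at least `d`. -/
theorem exists_separated_points {d : ℝ} (hd : 0 < d) (n : ℕ) :
    ∀ E : Set ℝ, IsCompact E → ENNReal.ofReal (n * d) < volume E →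
      ∃ x : ℕ → ℝ, (∀ i ≤ n, x i ∈ E) ∧ ∀ i < n, x i + d ≤ x (i + 1) := by
  induction n with
  | zero =>
    intro E _ hE
    have : E.Nonempty := by
      rw [Set.nonempty_iff_ne_empty]
      rintro rfl
      simp at hE
    obtain ⟨y, hy⟩ := this
    exact ⟨fun _ => y, fun _ _ => hy, fun i hi => absurd hi (Nat.not_lt_zero _)⟩
  | succ n ih =>
    intro E hEc hE
    have hne : E.Nonempty := by
      rw [Set.nonempty_iff_ne_empty]
      rintro rfl
      simp at hE
    obtain ⟨y, hyE, hy⟩ := hEc.exists_isLeast hne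
    -- Greedy choice: keep the leftmost point `y` and discard [y, y + d), which costs measure at
    -- most `d`.
    set E' := E ∩ Set.Ici (y + d) with hE'
    have hE'c : IsCompact E' := hEc.inter_right isClosed_Ici
    have hvol : ENNReal.ofReal (n * d) < volume E' := by
      have hsub : E ⊆ Set.Ico y (y + d) ∪ E' := by
        intro z hz
        by_cases h : z < y + d
        · exact Or.inl ⟨hy hz, h⟩
        · exact Or.inr ⟨hz, not_lt.1 h⟩
      have h1 : volume E ≤ ENNReal.ofReal d + volume E' := by
        refine (measure_mono hsub).trans ((measure_union_le _ _).trans ?_)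
        rw [Real.volume_Ico]; simp
      have h2 : ENNReal.ofReal ((n + 1 : ℕ) * d) = ENNReal.ofReal d + ENNReal.ofReal (n * d) := by
        rw [← ENNReal.ofReal_add hd.le (by positivity)]
        congr 1; push_cast; ring
      rw [h2] at hE
      exact (ENNReal.add_lt_add_iff_left ENNReal.ofReal_ne_top).1 (hE.trans_le h1)
    obtain ⟨x, hx1, hx2⟩ := ih E' hE'c hvol
    refine ⟨fun i => Nat.casesOn i y x, ?_, ?_⟩
    · rintro (_ | i) hi
      · exact hyE
      · exact (hx1 i (by omega)).1
    · rintro (_ | i) hi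
      · exact (hx1 0 (by omega)).2
      · exact hx2 i (by omega)

theorem separated_of_gaps {d : ℝ} {n : ℕ} {x : ℕ → ℝ}
    (hx : ∀ i < n, x i + d ≤ x (i + 1)) {i j : ℕ} (hij : i ≤ j) (hj : j ≤ n) :
    ((j : ℝ) - i) * d ≤ x j - x i := by
  induction j, hij using Nat.le_induction with
  | base => simp
  | succ k hk ih =>
    have h1 := ih (by omega)
    have h2 := hx k (by omega)
    push_cast
    nlinarith

theorem prod_abs_sub_eq (n j : ℕ) (hj : j ≤ n) :
    ∏ i ∈ (Finset.range (n + 1)).erase j, |(j : ℝ) - i| = (j.factorial * (n - j).factorial : ℕ) := by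
  have hsplit : (Finset.range (n + 1)).erase j = Finset.range j ∪ Finset.Ico (j + 1) (n + 1) := by
    ext i; simp; omega
  have hdisj : Disjoint (Finset.range j) (Finset.Ico (j + 1) (n + 1)) := by
    rw [Finset.disjoint_left]; intro i; simp; omega
  rw [hsplit, Finset.prod_union hdisj]
  push_cast
  congr 1
  · rw [← Finset.prod_range_reflect, ← Finset.prod_range_add_one_eq_factorial]
    push_cast
    refine Finset.prod_congr rfl fun i hi => ?_
    have hi' : i + 1 ≤ j := by simpa using hi
    have : ((j - 1 - i : ℕ) : ℝ) = j - 1 - i := by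
      rw [Nat.sub_sub, Nat.cast_sub (by omega)]; push_cast; ring
    rw [this, abs_of_nonneg] <;> ring_nf
    positivity
  · rw [Finset.prod_Ico_eq_prod_range, ← Finset.prod_range_add_one_eq_factorial,
      Nat.add_sub_add_right]
    push_cast
    refine Finset.prod_congr rfl fun i hi => ?_
    rw [abs_of_nonpos] <;> linarith [Nat.cast_nonneg (α := ℝ) i]

/-- A binomial coefficient is at most 2^n. This makes the bound on the Lagrange basis polynomials
independent of the node. -/
theorem factorial_le_two_pow_mul (n j : ℕ) (hj : j ≤ n) :
    (n.factorial : ℝ) ≤ 2 ^ n * (j.factorial * (n - j).factorial : ℕ) := by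
  have h1 := Nat.choose_mul_factorial_mul_factorial hj
  have h2 : n.choose j ≤ 2 ^ n := Nat.choose_le_two_pow n j
  have : n.factorial ≤ 2 ^ n * (j.factorial * (n - j).factorial) := by
    rw [← h1, mul_assoc]
    exact Nat.mul_le_mul_right _ h2
  exact_mod_cast this

/-- Both x^n/n! ≤ e^x and x ≤ e^x are taken at x = n + 1. The extra factor n + 1 absorbs the number
of terms of the interpolation sum. -/
theorem succ_pow_le_exp_mul_factorial (n : ℕ) :
    ((n : ℝ) + 1) * ((n : ℝ) + 1) ^ n ≤ Real.exp (2 * (n + 1)) * n.factorial := by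
  have h1 : ((n : ℝ) + 1) ^ n / n.factorial ≤ Real.exp (n + 1) :=
    Real.pow_div_factorial_le_exp _ (by positivity) n
  have h2 : ((n : ℝ) + 1) ≤ Real.exp (n + 1) := by
    linarith [Real.add_one_le_exp ((n : ℝ) + 1)]
  rw [div_le_iff₀ (by positivity)] at h1
  have : Real.exp (2 * (n + 1)) = Real.exp (n + 1) * Real.exp (n + 1) := by
    rw [← Real.exp_add]; ring_nf
  rw [this]
  calc ((n : ℝ) + 1) * ((n : ℝ) + 1) ^ n
      ≤ Real.exp (n + 1) * (Real.exp (n + 1) * n.factorial) := by gcongr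
    _ = _ := by ring

/-- The Lagrange interpolation polynomial of `f` with nodes `x 0, …, x n`. -/
noncomputable def lagrange (f : ℂ → ℂ) (x : ℕ → ℝ) (n : ℕ) (z : ℂ) : ℂ :=
  ∑ j ∈ Finset.range (n + 1), f (x j) *
    ∏ i ∈ (Finset.range (n + 1)).erase j, (z - x i) / ((x j : ℂ) - x i)

theorem differentiable_lagrange (f : ℂ → ℂ) (x : ℕ → ℝ) (n : ℕ) :
    Differentiable ℂ (lagrange f x n) := by
  unfold lagrange
  fun_prop

theorem lagrange_apply_node {f : ℂ → ℂ} {x : ℕ → ℝ} {n : ℕ}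
    (hx : ∀ i ≤ n, ∀ j ≤ n, x i = x j → i = j) {k : ℕ} (hk : k ≤ n) :
    lagrange f x n (x k) = f (x k) := by
  unfold lagrange
  rw [Finset.sum_eq_single k]
  · rw [Finset.prod_eq_one, mul_one]
    intro i hi
    simp only [Finset.mem_erase, Finset.mem_range] at hi
    refine div_self ?_
    rw [sub_ne_zero]
    intro h
    exact hi.1 (hx k hk i (by omega) (Complex.ofReal_injective h)).symm
  · intro j _ hjk
    rw [Finset.prod_eq_zero (i := k), mul_zero]
    · simp only [Finset.mem_erase, Finset.mem_range]
      exact ⟨hjk.symm, by omega⟩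
    · simp
  · intro h
    exact absurd (Finset.mem_range.2 (by omega)) h

/-- Nodes with gaps at least `d` are at least as far apart as those of an arithmetic progression of
step `d`, whose Lagrange denominators are d^n j!(n-j)!. -/
theorem norm_lagrange_le {f : ℂ → ℂ} {x : ℕ → ℝ} {n : ℕ} {d r δ : ℝ} (hd : 0 < d)
    (hx : ∀ i < n, x i + d ≤ x (i + 1)) (hf : ∀ i ≤ n, ‖f (x i)‖ ≤ δ) {z : ℂ}
    (hz : ∀ i ≤ n, ‖z - x i‖ ≤ r) :
    ‖lagrange f x n z‖ ≤ (n + 1) * (δ * ((2 * r / d) ^ n / n.factorial)) := by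
  have hr : 0 ≤ r := (norm_nonneg _).trans (hz 0 (Nat.zero_le _))
  have hδ : 0 ≤ δ := (norm_nonneg _).trans (hf 0 (Nat.zero_le _))
  unfold lagrange
  have hcard : ((n : ℝ) + 1) * (δ * ((2 * r / d) ^ n / n.factorial)) =
      ∑ _j ∈ Finset.range (n + 1), δ * ((2 * r / d) ^ n / n.factorial) := by
    simp
  rw [hcard]
  refine norm_sum_le_of_le _ fun j hj => ?_
  have hjn : j ≤ n := by simpa [Nat.lt_succ_iff] using hj
  rw [norm_mul, norm_prod]
  gcongr
  · exact hf j hjn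
  have hsep : ∀ i ∈ (Finset.range (n + 1)).erase j, |(j : ℝ) - i| * d ≤ ‖(x j : ℂ) - x i‖ := by
    intro i hi
    simp only [Finset.mem_erase, Finset.mem_range] at hi
    rw [← Complex.ofReal_sub, Complex.norm_real, Real.norm_eq_abs]
    rcases le_total i j with h | h
    · have h1 := separated_of_gaps hx h hjn
      rw [abs_of_nonneg (sub_nonneg.2 (by exact_mod_cast h))]
      exact h1.trans (le_abs_self _)
    · have h1 := separated_of_gaps hx h (by omega)
      rw [abs_of_nonpos (sub_nonpos.2 (by exact_mod_cast h)), abs_sub_comm, neg_sub]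
      exact h1.trans (le_abs_self _)
  have hpos : ∀ i ∈ (Finset.range (n + 1)).erase j, 0 < |(j : ℝ) - i| * d := by
    intro i hi
    simp only [Finset.mem_erase, Finset.mem_range] at hi
    have : (j : ℝ) - i ≠ 0 := by
      rw [sub_ne_zero]
      exact_mod_cast Ne.symm hi.1
    positivity
  have hcard' : ((Finset.range (n + 1)).erase j).card = n := by
    rw [Finset.card_erase_of_mem hj]; simp
  calc ∏ i ∈ (Finset.range (n + 1)).erase j, ‖(z - x i) / ((x j : ℂ) - x i)‖
      ≤ ∏ i ∈ (Finset.range (n + 1)).erase j, r / (|(j : ℝ) - i| * d) := by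
        refine Finset.prod_le_prod (fun _ _ => norm_nonneg _) fun i hi => ?_
        rw [norm_div]
        have h1 := hz i (by simp only [Finset.mem_erase, Finset.mem_range] at hi; omega)
        exact div_le_div₀ hr h1 (hpos i hi) (hsep i hi)
    _ = (r / d) ^ n / (j.factorial * (n - j).factorial : ℕ) := by
        rw [← prod_abs_sub_eq n j hjn, Finset.prod_div_distrib, Finset.prod_mul_distrib,
          Finset.prod_const, Finset.prod_const, hcard', div_pow, div_div, mul_comm (d ^ n)]
    _ ≤ (2 * r / d) ^ n / n.factorial := by
        have h1 := factorial_le_two_pow_mul n j hjn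
        have h2 : (0 : ℝ) < (j.factorial * (n - j).factorial : ℕ) := by positivity
        rw [div_le_div_iff₀ h2 (by positivity)]
        have h3 : (2 * r / d) ^ n = (r / d) ^ n * 2 ^ n := by rw [← mul_pow]; ring
        rw [h3, mul_assoc]
        gcongr

/-- A Remez type inequality for entire functions. -/
theorem norm_apply_zero_le_of_small_on {f : ℂ → ℂ} (hf : Differentiable ℂ f) {R m M δ : ℝ}
    (hR : 0 < R) (hm : 0 < m) (hmR : m ≤ 2 * R) {E : Set ℝ} (hE : IsCompact E)
    (hER : ∀ x ∈ E, |x| ≤ R) (hvol : ENNReal.ofReal m ≤ volume E)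
    (hM : ∀ z, ‖z‖ = Real.exp 1 * R → ‖f z‖ ≤ M) (hδ : ∀ x ∈ E, ‖f x‖ ≤ δ) {n : ℕ}
    (hn : 0 < n) :
    ‖f 0‖ ≤ M * Real.exp (-n) + 2 * δ * (8 * Real.exp 2 * R / m) ^ n := by
  obtain ⟨k, rfl⟩ : ∃ k, n = k + 1 := ⟨n - 1, by omega⟩
  have he : 2 ≤ Real.exp 1 := by linarith [Real.add_one_le_exp (1 : ℝ)]
  have he3 : Real.exp 1 ≤ 3 := by linarith [Real.exp_one_lt_d9]
  -- `k` gaps of this length total less than `m`, so `k + 1 = n` nodes fit into `E`.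
  set d : ℝ := m / (k + 1) with hd_def
  have hd : 0 < d := by positivity
  obtain ⟨x, hxE, hx⟩ := exists_separated_points hd k E hE (by
    refine lt_of_lt_of_le ?_ hvol
    rw [ENNReal.ofReal_lt_ofReal_iff hm, hd_def, mul_div_assoc', div_lt_iff₀ (by positivity)]
    nlinarith)
  have hinj : ∀ i ≤ k, ∀ j ≤ k, x i = x j → i = j := by
    intro i hi j hj hij
    rcases lt_trichotomy i j with h | h | h
    · have h1 := separated_of_gaps hx h.le hj
      have h2 : (i : ℝ) < j := by exact_mod_cast h
      nlinarith
    · exact h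
    · have h1 := separated_of_gaps hx h.le hi
      have h2 : (j : ℝ) < i := by exact_mod_cast h
      nlinarith
  have hδ0 : 0 ≤ δ := (norm_nonneg _).trans (hδ _ (hxE 0 (Nat.zero_le _)))
  set Λ : ℝ := δ * (8 * Real.exp 2 * R / m) ^ (k + 1) with hΛ
  have hL : ∀ z : ℂ, ‖z‖ ≤ Real.exp 1 * R → ‖lagrange f x k z‖ ≤ Λ := by
    intro z hz
    -- The distance to a node is at most eR + R ≤ 4R.
    have h1 := norm_lagrange_le (r := 4 * R) hd hx (fun i hi => hδ _ (hxE i hi)) (z := z) (by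
      intro i hi
      have h2 : ‖(x i : ℂ)‖ ≤ R := by
        rw [Complex.norm_real]; exact hER _ (hxE i hi)
      refine (norm_sub_le _ _).trans ?_
      nlinarith)
    refine h1.trans ?_
    have h2 := succ_pow_le_exp_mul_factorial k
    have h3 : (2 * (4 * R) / d) ^ k = (8 * R / m) ^ k * ((k : ℝ) + 1) ^ k := by
      rw [hd_def, ← mul_pow]; congr 1; field_simp; ring
    have h4 : Real.exp (2 * (k + 1)) = Real.exp 2 ^ (k + 1) := by
      rw [← Real.exp_nat_mul]; push_cast; ring_nf
    rw [h3]
    calc ((k : ℝ) + 1) * (δ * ((8 * R / m) ^ k * ((k : ℝ) + 1) ^ k / k.factorial))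
        = δ * (8 * R / m) ^ k * ((((k : ℝ) + 1) * ((k : ℝ) + 1) ^ k) / k.factorial) := by ring
      _ ≤ δ * (8 * R / m) ^ k * Real.exp 2 ^ (k + 1) := by
          gcongr
          rw [div_le_iff₀ (by positivity), ← h4]
          exact h2
      -- Raising the exponent is allowed since `m ≤ 2R` gives `8R/m ≥ 1`.
      _ ≤ δ * (8 * R / m) ^ (k + 1) * Real.exp 2 ^ (k + 1) := by
          gcongr
          · rw [le_div_iff₀ hm]; linarith
          · omega
      _ = Λ := by
          rw [hΛ, mul_assoc, ← mul_pow]; congr 2; ring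
  have hΛ0 : 0 ≤ Λ := by positivity
  set S : Finset ℂ := (Finset.range (k + 1)).image fun i => (x i : ℂ) with hS
  have hSmem : ∀ w ∈ S, ∃ i ≤ k, w = x i := by
    intro w hw
    rw [hS, Finset.mem_image] at hw
    obtain ⟨i, hi, rfl⟩ := hw
    exact ⟨i, by simpa [Nat.lt_succ_iff] using hi, rfl⟩
  have hSnorm : ∀ w ∈ S, ‖w‖ ≤ R := by
    intro w hw
    obtain ⟨i, hi, rfl⟩ := hSmem w hw
    rw [Complex.norm_real]
    exact hER _ (hxE i hi)
  have hcard : S.card = k + 1 := by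
    rw [hS, Finset.card_image_of_injOn, Finset.card_range]
    intro i hi j hj hij
    simp only [Finset.coe_range, Set.mem_Iio] at hi hj
    exact hinj i (by omega) j (by omega) (Complex.ofReal_injective hij)
  have hprod : ∏ w ∈ S, (‖w‖ / (Real.exp 1 * R)) ≤ Real.exp (-((k + 1 : ℕ) : ℝ)) := by
    have h1 : Real.exp (-((k + 1 : ℕ) : ℝ)) = ∏ _w ∈ S, Real.exp (-1) := by
      rw [Finset.prod_const, hcard, ← Real.exp_nat_mul]; ring_nf
    rw [h1]
    refine Finset.prod_le_prod (fun _ _ => by positivity) fun w hw => ?_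
    rw [div_le_iff₀ (by positivity), ← mul_assoc, ← Real.exp_add]
    simpa using hSnorm w hw
  have hM0 : 0 ≤ M := by
    refine (norm_nonneg _).trans (hM ((Real.exp 1 * R : ℝ) : ℂ) ?_)
    rw [Complex.norm_real, Real.norm_eq_abs, abs_of_pos (by positivity)]
  -- The difference vanishes at all nodes; these have modulus at most `R` and the circle has radius
  -- eR, so each zero contributes a factor at most 1/e.
  have hmain := norm_apply_zero_le_of_zeros (ρ := Real.exp 1 * R) (M := M + Λ) (by positivity) S
    (fun z => f z - lagrange f x k z) (hf.sub (differentiable_lagrange f x k))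
    (by
      intro w hw
      obtain ⟨i, hi, rfl⟩ := hSmem w hw
      rw [lagrange_apply_node hinj hi, sub_self])
    (by
      intro w hw
      have := hSnorm w hw
      nlinarith)
    (fun z hz => (norm_sub_le _ _).trans (add_le_add (hM z hz) (hL z hz.le)))
  have h0 : ‖f 0‖ ≤ ‖f 0 - lagrange f x k 0‖ + ‖lagrange f x k 0‖ := by
    simpa using norm_add_le (f 0 - lagrange f x k 0) (lagrange f x k 0)
  have hL0 := hL 0 (by rw [norm_zero]; positivity)
  have hexp : Real.exp (-((k + 1 : ℕ) : ℝ)) ≤ 1 := Real.exp_le_one_iff.2 (by linarith [Nat.cast_nonneg (α := ℝ) (k + 1)])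
  calc ‖f 0‖ ≤ (M + Λ) * Real.exp (-((k + 1 : ℕ) : ℝ)) + Λ :=
        h0.trans (add_le_add (hmain.trans (by gcongr)) hL0)
    _ ≤ M * Real.exp (-((k + 1 : ℕ) : ℝ)) + 2 * Λ := by nlinarith
    _ = _ := by rw [hΛ]; ring

/-! ### Fourier transforms on L¹ and L²: convolution theorem and injectivity -/

open SchwartzMap in
/-- The Fourier transform of `L²` is self-adjoint for the bilinear pairing with test functions. -/
theorem integral_schwartz_mul_fourier (f : L2) (H : 𝓢(ℝ, ℂ)) :
    ∫ y, H y * (𝓕 f : L2) y = ∫ t, (𝓕 H : 𝓢(ℝ, ℂ)) t * f t := by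
  have h := Lp.fourier_toTemperedDistribution_eq f
  have h1 := congrArg (fun T : TemperedDistribution ℝ ℂ => T H) h
  simp only [TemperedDistribution.fourier_apply, Lp.toTemperedDistribution_apply,
    smul_eq_mul] at h1
  exact h1.symm

/-- A character times a smooth compactly supported function. -/
noncomputable def modulate (h : ℝ → ℝ) (s x : ℝ) : ℂ :=
  Complex.exp (-(2 * Real.pi * Complex.I * s * x)) * (h x : ℂ)

theorem contDiff_modulate {h : ℝ → ℝ} (hh : ContDiff ℝ (⊤ : ℕ∞) h) (s : ℝ) :
    ContDiff ℝ (⊤ : ℕ∞) (modulate h s) := by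
  unfold modulate
  have h1 : ContDiff ℝ (⊤ : ℕ∞) (fun x : ℝ => (x : ℂ)) := Complex.ofRealCLM.contDiff
  have h2 : ContDiff ℝ (⊤ : ℕ∞) (fun x : ℝ => (h x : ℂ)) := Complex.ofRealCLM.contDiff.comp hh
  fun_prop

theorem hasCompactSupport_modulate {h : ℝ → ℝ} (hh : HasCompactSupport h) (s : ℝ) :
    HasCompactSupport (modulate h s) := by
  unfold modulate
  exact HasCompactSupport.mul_left (hh.comp_left (g := fun x : ℝ => (x : ℂ)) (by simp))

/-- The modulated test function as a Schwartz function. -/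
noncomputable def modulateSchwartz {h : ℝ → ℝ} (hh : ContDiff ℝ (⊤ : ℕ∞) h)
    (hc : HasCompactSupport h) (s : ℝ) : SchwartzMap ℝ ℂ :=
  (hasCompactSupport_modulate hc s).toSchwartzMap (contDiff_modulate hh s)

theorem modulateSchwartz_apply {h : ℝ → ℝ} (hh : ContDiff ℝ (⊤ : ℕ∞) h)
    (hc : HasCompactSupport h) (s x : ℝ) :
    modulateSchwartz hh hc s x = modulate h s x := rfl

/-- Modulation becomes translation; this is how the shift in the convolution turns into the
character in `hat φ`. -/
theorem fourier_modulateSchwartz {h : ℝ → ℝ} (hh : ContDiff ℝ (⊤ : ℕ∞) h)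
    (hc : HasCompactSupport h) (s t : ℝ) :
    (𝓕 (modulateSchwartz hh hc s) : SchwartzMap ℝ ℂ) t =
      (𝓕 (modulateSchwartz hh hc 0) : SchwartzMap ℝ ℂ) (t + s) := by
  rw [SchwartzMap.fourier_coe, SchwartzMap.fourier_coe, Real.fourier_real_eq_integral_exp_smul,
    Real.fourier_real_eq_integral_exp_smul]
  refine integral_congr_ae (Eventually.of_forall fun x => ?_)
  simp only [modulateSchwartz_apply, modulate, smul_eq_mul]
  rw [← mul_assoc, ← mul_assoc, ← Complex.exp_add, ← Complex.exp_add]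
  congr 2
  push_cast
  ring

theorem hat_eq (φ : ℝ → ℂ) (y : ℝ) :
    hat φ (2 * Real.pi * y) = ∫ s : ℝ, Complex.exp (-(2 * Real.pi * Complex.I * s * y)) * φ s := by
  unfold hat
  congr 1
  ext t
  congr 2
  push_cast
  ring

theorem norm_hat_le (φ : ℝ → ℂ) (x : ℝ) : ‖hat φ x‖ ≤ norm1 φ := by
  unfold hat norm1
  refine (norm_integral_le_integral_norm _).trans (le_of_eq ?_)
  congr 1
  ext t
  rw [norm_mul, Complex.norm_exp]
  simp

theorem continuous_hat {φ : ℝ → ℂ} (hφ : Integrable φ volume) : Continuous (hat φ) := by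
  unfold hat
  refine continuous_of_dominated (bound := fun t => ‖φ t‖) ?_ ?_ hφ.norm ?_
  · intro x
    refine AEStronglyMeasurable.mul ?_ hφ.1
    exact Continuous.aestronglyMeasurable (by fun_prop)
  · intro x
    refine Eventually.of_forall fun t => ?_
    rw [norm_mul, Complex.norm_exp]
    simp
  · refine Eventually.of_forall fun t => ?_
    fun_prop

/-- Justifies Fubini in the convolution theorem: |k(t) f(t-s)| ≤ |k(t)|² + |f(t-s)|² bounds the
inner integral uniformly in `s`, leaving the integrable factor |φ(s)|. -/
theorem integrable_mul_translate (k : SchwartzMap ℝ ℂ) (f : L2) {φ : ℝ → ℂ}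
    (hφ : Integrable φ volume) :
    Integrable (fun z : ℝ × ℝ => k z.1 * (f (z.1 - z.2) * φ z.2)) (volume.prod volume) := by
  have hfm : StronglyMeasurable (f : ℝ → ℂ) := Lp.stronglyMeasurable f
  have hk2 : MemLp k 2 volume := k.memLp 2 volume
  have hmeas : AEStronglyMeasurable (fun z : ℝ × ℝ => k z.1 * (f (z.1 - z.2) * φ z.2))
      (volume.prod volume) := by
    refine AEStronglyMeasurable.mul ?_ (AEStronglyMeasurable.mul ?_ hφ.1.comp_snd)
    · exact (k.continuous.comp continuous_fst).aestronglyMeasurable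
    · exact (hfm.comp_measurable (by fun_prop)).aestronglyMeasurable
  have hf2 : ∀ s : ℝ, MemLp (fun t => f (t - s)) 2 volume := fun s =>
    (Lp.memLp f).comp_measurePreserving (measurePreserving_sub_right volume s)
  have hint : ∀ s : ℝ, Integrable (fun t => k t * f (t - s)) volume := fun s =>
    hk2.integrable_mul (hf2 s)
  rw [integrable_prod_iff' hmeas]
  constructor
  · refine Eventually.of_forall fun s => ?_
    have := (hint s).mul_const (φ s)
    simpa only [mul_assoc] using this
  · set K : ℝ := ∫ t, ‖k t‖ ^ 2 + ‖f t‖ ^ 2 with hK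
    have hkI : Integrable (fun t => ‖k t‖ ^ 2) volume := hk2.integrable_norm_pow (by norm_num)
    have hfI : Integrable (fun t => ‖f t‖ ^ 2) volume :=
      (Lp.memLp f).integrable_norm_pow (by norm_num)
    refine Integrable.mono' (hφ.norm.const_mul K) hmeas.norm.prod_swap.integral_prod_right' ?_
    refine Eventually.of_forall fun s => ?_
    have h1 : ∫ t, ‖k t * (f (t - s) * φ s)‖ = (∫ t, ‖k t * f (t - s)‖) * ‖φ s‖ := by
      rw [← integral_mul_const]
      congr 1
      ext t
      simp only [norm_mul]
      ring
    have h2 : ∫ t, ‖k t * f (t - s)‖ ≤ K := by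
      have h3 : K = ∫ t, ‖k t‖ ^ 2 + ‖f (t - s)‖ ^ 2 := by
        have h4 : Integrable (fun t => ‖f (t - s)‖ ^ 2) volume := hfI.comp_sub_right s
        rw [hK, integral_add hkI hfI, integral_add hkI h4,
          integral_sub_right_eq_self (fun t => ‖f t‖ ^ 2) s]
      rw [h3]
      refine integral_mono (hint s).norm (hkI.add (hfI.comp_sub_right s)) fun t => ?_
      simp only [norm_mul]
      nlinarith [sq_nonneg (‖k t‖ - ‖f (t - s)‖), norm_nonneg (k t), norm_nonneg (f (t - s))]
    simp only
    rw [h1, Real.norm_of_nonneg (by positivity)]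
    gcongr

/-- The convolution theorem for the convolution of an integrable with a square integrable
function. -/
theorem fourier_solution {φ : ℝ → ℂ} (hφ : Integrable φ volume) {f g : L2}
    (h : IsSolution φ f g) :
    ∀ᵐ y : ℝ, (𝓕 g : L2) y = hat φ (2 * Real.pi * y) * (𝓕 f : L2) y := by
  have hcont : Continuous fun y : ℝ => hat φ (2 * Real.pi * y) :=
    (continuous_hat hφ).comp (by fun_prop)
  have hloc : ∀ f : L2, LocallyIntegrable (f : ℝ → ℂ) volume := fun f =>
    (Lp.memLp f).locallyIntegrable (by norm_num)
  -- Test against smooth compactly supported `w`: move the transform from `g` to `w`, insert the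
  -- convolution, exchange integrals, and move the transform back for each fixed shift `s`.
  refine ae_eq_of_integral_contDiff_smul_eq (hloc _) ?_ fun w hw hc => ?_
  · rw [← locallyIntegrableOn_univ]
    exact (locallyIntegrableOn_univ.2 (hloc (𝓕 f : L2))).continuousOn_mul hcont.continuousOn
      isOpen_univ.isLocallyClosed
  have h0 : ∀ x, modulateSchwartz hw hc 0 x = (w x : ℂ) := fun x => by
    simp [modulateSchwartz_apply, modulate]
  set k : SchwartzMap ℝ ℂ := 𝓕 (modulateSchwartz hw hc 0) with hk
  have hprod : Integrable (fun z : ℝ × ℝ => (w z.1 : ℂ) * (𝓕 f : L2) z.1 * φ z.2)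
      (volume.prod volume) := by
    refine Integrable.mul_prod (f := fun y => (w y : ℂ) * (𝓕 f : L2) y) ?_ hφ
    have := ((modulateSchwartz hw hc 0).memLp 2 volume).integrable_mul (Lp.memLp (𝓕 f : L2))
    refine this.congr (Eventually.of_forall fun x => ?_)
    simp [h0]
  calc ∫ y, w y • (𝓕 g : L2) y
      = ∫ y, modulateSchwartz hw hc 0 y * (𝓕 g : L2) y := by
        simp only [h0, Complex.real_smul]
    _ = ∫ t, k t * g t := integral_schwartz_mul_fourier g _
    _ = ∫ t, ∫ s, k t * (f (t - s) * φ s) := by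
        refine integral_congr_ae ?_
        filter_upwards [h] with t ht
        rw [integral_const_mul, ht]
    _ = ∫ s, ∫ t, k t * (f (t - s) * φ s) :=
        integral_integral_swap (f := fun t s => k t * (f (t - s) * φ s))
          (integrable_mul_translate k f hφ)
    _ = ∫ s, ∫ y, modulate w s y * (𝓕 f : L2) y * φ s := by
        congr 1
        ext s
        rw [integral_mul_const]
        have h1 := integral_schwartz_mul_fourier f (modulateSchwartz hw hc s)
        simp only [modulateSchwartz_apply] at h1
        rw [h1]
        have h2 : ∫ t, k t * (f (t - s) * φ s) = (∫ t, k t * f (t - s)) * φ s := by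
          rw [← integral_mul_const]; simp only [mul_assoc]
        rw [h2, ← integral_add_right_eq_self (fun t => k t * f (t - s)) s]
        congr 2
        ext t
        rw [fourier_modulateSchwartz hw hc s, add_sub_cancel_right]
    _ = ∫ y, ∫ s, modulate w s y * (𝓕 f : L2) y * φ s := by
        refine integral_integral_swap ?_
        have hswap : Integrable (fun z : ℝ × ℝ => (w z.2 : ℂ) * (𝓕 f : L2) z.2 * φ z.1)
          (volume.prod volume) := hprod.swap
        refine (hswap.bdd_mul (c := 1)
          (f := fun z : ℝ × ℝ => Complex.exp (-(2 * Real.pi * Complex.I * z.1 * z.2)))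
          ?_ ?_).congr ?_
        · exact Continuous.aestronglyMeasurable (by fun_prop)
        · refine Eventually.of_forall fun z => ?_
          rw [Complex.norm_exp]
          simp
        · refine Eventually.of_forall fun z => ?_
          simp only [modulate, Function.uncurry]
          ring
    _ = ∫ y, w y • (hat φ (2 * Real.pi * y) * (𝓕 f : L2) y) := by
        congr 1
        ext y
        rw [hat_eq, Complex.real_smul, mul_comm (integral _ _), ← mul_assoc, ← integral_const_mul]
        congr 1
        ext s
        simp only [modulate]
        ring

/-- Injectivity of the transform on L¹: every test function is the transform of a Schwartz function,
so by duality a vanishing transform makes `φ` pair to zero with all of them. -/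
theorem exists_hat_ne_zero {φ : ℝ → ℂ} (hφ : Integrable φ volume) (h0 : ¬ φ =ᵐ[volume] 0) :
    ∃ x, hat φ x ≠ 0 := by
  by_contra! hall
  apply h0
  have hF : ∀ y : ℝ, 𝓕 φ y = 0 := by
    intro y
    rw [Real.fourier_real_eq_integral_exp_smul, ← hall (2 * Real.pi * y)]
    unfold hat
    congr 1
    ext t
    rw [smul_eq_mul]
    congr 2
    push_cast
    ring
  refine ae_eq_zero_of_integral_contDiff_smul_eq_zero hφ.locallyIntegrable fun g hg hc => ?_
  have hc' : HasCompactSupport (Complex.ofRealCLM ∘ g) := hc.comp_left rfl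
  have hg' : ContDiff ℝ (⊤ : ℕ∞) (Complex.ofRealCLM ∘ g) := by fun_prop
  set G : SchwartzMap ℝ ℂ := hc'.toSchwartzMap hg' with hG
  have h1 : ∫ y, 𝓕 φ y • (𝓕⁻ G : SchwartzMap ℝ ℂ) y =
      ∫ y, φ y • 𝓕 ((𝓕⁻ G : SchwartzMap ℝ ℂ) : ℝ → ℂ) y := by
    have h := VectorFourier.integral_fourierIntegral_smul_eq_flip (L := innerₗ ℝ) (f := φ)
      (g := (𝓕⁻ G : SchwartzMap ℝ ℂ)) Real.continuous_fourierChar continuous_inner hφ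
      ((𝓕⁻ G : SchwartzMap ℝ ℂ).integrable (μ := volume))
    rwa [flip_innerₗ] at h
  have h2 : ∀ x, 𝓕 ((𝓕⁻ G : SchwartzMap ℝ ℂ) : ℝ → ℂ) x = (g x : ℂ) := by
    intro x
    rw [← SchwartzMap.fourier_coe, FourierTransform.fourier_fourierInv_eq]
    rfl
  simp only [hF, zero_smul, integral_zero, h2] at h1
  rw [h1]
  congr 1
  ext x
  simp [mul_comm]

/-! ### The truncated transform as an entire function of exponential type -/

/-- The Fourier transform of the restriction of `φ` to `[-s, s]`, as an entire function. -/
noncomputable def truncHat (φ : ℝ → ℂ) (s : ℝ) (z : ℂ) : ℂ :=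
  ∫ t in Set.Icc (-s) s, Complex.exp (-(Complex.I * z * t)) * φ t

theorem norm_exp_le_of_abs_le {s t : ℝ} (ht : |t| ≤ s) (z : ℂ) :
    ‖Complex.exp (-(Complex.I * z * t))‖ ≤ Real.exp (s * |z.im|) := by
  rw [Complex.norm_exp, Real.exp_le_exp]
  have : (-(Complex.I * z * t)).re = t * z.im := by simp; ring
  rw [this]
  calc t * z.im ≤ |t * z.im| := le_abs_self _
    _ = |t| * |z.im| := abs_mul _ _
    _ ≤ s * |z.im| := by gcongr

theorem norm_truncHat_le {φ : ℝ → ℂ} (hφ : Integrable φ volume) (s : ℝ) (z : ℂ) :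
    ‖truncHat φ s z‖ ≤ norm1 φ * Real.exp (s * |z.im|) := by
  unfold truncHat norm1
  calc ‖∫ t in Set.Icc (-s) s, Complex.exp (-(Complex.I * z * t)) * φ t‖
      ≤ ∫ t in Set.Icc (-s) s, Real.exp (s * |z.im|) * ‖φ t‖ := by
        refine norm_integral_le_of_norm_le (hφ.norm.const_mul _).integrableOn ?_
        rw [ae_restrict_iff' measurableSet_Icc]
        refine Eventually.of_forall fun t ht => ?_
        rw [norm_mul]
        gcongr
        exact norm_exp_le_of_abs_le (abs_le.2 ht) z
    _ = Real.exp (s * |z.im|) * ∫ t in Set.Icc (-s) s, ‖φ t‖ := integral_const_mul _ _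
    _ ≤ Real.exp (s * |z.im|) * ∫ t, ‖φ t‖ := by
        refine mul_le_mul_of_nonneg_left ?_ (Real.exp_pos _).le
        exact setIntegral_le_integral hφ.norm (Eventually.of_forall fun _ => norm_nonneg _)
    _ = _ := mul_comm _ _

theorem differentiable_truncHat {φ : ℝ → ℂ} (hφ : Integrable φ volume) (s : ℝ) :
    Differentiable ℂ (truncHat φ s) := by
  intro z₀
  have hmeas : ∀ z : ℂ, AEStronglyMeasurable (fun t : ℝ => Complex.exp (-(Complex.I * z * t)) * φ t)
      (volume.restrict (Set.Icc (-s) s)) := fun z =>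
    AEStronglyMeasurable.mul (Continuous.aestronglyMeasurable (by fun_prop)) hφ.1.restrict
  refine (hasDerivAt_integral_of_dominated_loc_of_deriv_le (μ := volume.restrict (Set.Icc (-s) s))
    (F := fun (z : ℂ) (t : ℝ) => Complex.exp (-(Complex.I * z * t)) * φ t)
    (F' := fun (z : ℂ) (t : ℝ) =>
      (Complex.exp (-(Complex.I * z * t)) * (-(Complex.I * t))) * φ t)
    -- On the unit ball about `z₀` one has |Im z| ≤ ‖z₀‖ + 1, and |t| ≤ |s| on the domain of
    -- integration.
    (bound := fun t => Real.exp (|s| * (‖z₀‖ + 1)) * |s| * ‖φ t‖)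
    (Metric.ball_mem_nhds z₀ one_pos) (Eventually.of_forall hmeas) ?_ ?_ ?_ ?_
    ?_).2.differentiableAt
  · refine Integrable.mono' (hφ.norm.const_mul (Real.exp (|s| * |z₀.im|))).integrableOn (hmeas _) ?_
    rw [ae_restrict_iff' measurableSet_Icc]
    refine Eventually.of_forall fun t ht => ?_
    rw [norm_mul]
    gcongr
    exact norm_exp_le_of_abs_le ((abs_le.2 ht).trans (le_abs_self s)) z₀
  · exact AEStronglyMeasurable.mul (Continuous.aestronglyMeasurable (by fun_prop)) hφ.1.restrict
  · rw [ae_restrict_iff' measurableSet_Icc]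
    refine Eventually.of_forall fun t ht z hz => ?_
    have hts : |t| ≤ |s| := (abs_le.2 ht).trans (le_abs_self s)
    have hz1 : |z.im| ≤ ‖z₀‖ + 1 := by
      refine (Complex.abs_im_le_norm z).trans ?_
      rw [Metric.mem_ball, dist_eq_norm] at hz
      have := norm_add_le (z - z₀) z₀
      rw [sub_add_cancel] at this
      linarith
    rw [norm_mul, norm_mul]
    gcongr
    · exact (norm_exp_le_of_abs_le hts z).trans (Real.exp_le_exp.2 (by gcongr))
    · simpa using hts
  · exact (hφ.norm.const_mul _).integrableOn
  · refine Eventually.of_forall fun t z _ => ?_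
    have h1 : HasDerivAt (fun z : ℂ => -(Complex.I * z * t)) (-(Complex.I * t)) z := by
      have := (((hasDerivAt_id z).const_mul Complex.I).mul_const (t : ℂ)).neg
      rw [mul_one] at this
      exact this
    exact h1.cexp.mul_const (φ t)

/-- The truncation error is controlled by the mass of `φ` outside `[-s, s]`. -/
theorem norm_hat_sub_truncHat_le {φ : ℝ → ℂ} (hφ : Integrable φ volume) (s x : ℝ) :
    ‖hat φ x - truncHat φ s x‖ ≤ ∫ t in (Set.Icc (-s) s)ᶜ, ‖φ t‖ := by
  have hint : Integrable (fun t : ℝ => Complex.exp (-(Complex.I * x * t)) * φ t) volume := by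
    refine hφ.bdd_mul (c := 1) (Continuous.aestronglyMeasurable (by fun_prop)) ?_
    refine Eventually.of_forall fun t => ?_
    rw [Complex.norm_exp]
    simp
  unfold hat truncHat
  rw [← integral_add_compl (measurableSet_Icc (a := -s) (b := s)) hint, add_sub_cancel_left]
  refine (norm_integral_le_integral_norm _).trans (le_of_eq ?_)
  congr 1
  ext t
  rw [norm_mul, Complex.norm_exp]
  simp

/-! ### Measure of the set where the truncated transform is small -/

theorem eventually_log_add_le (a b : ℝ) {c : ℝ} (hc : 0 < c) :
    ∀ᶠ R : ℝ in atTop, a * Real.log R + b ≤ c * R := by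
  have h : (fun R : ℝ => a * Real.log R + b) =o[atTop] (id : ℝ → ℝ) :=
    (Real.isLittleO_log_id_atTop.const_mul_left a).add (Asymptotics.isLittleO_const_id_atTop b)
  filter_upwards [h.def hc, eventually_ge_atTop 0] with R h1 h2
  rw [id, Real.norm_of_nonneg h2] at h1
  exact (le_abs_self _).trans h1

/-- Here `l` is log R. The product supplies (2q+1)·esRl and the `n` term consumes 2q·esRl, leaving
esRl. As `l ≥ c₂ + 1`, this pays for esRc₂ and still leaves esR ≥ 2sR: one sR covers the terms with
`K`, the other those with `L`, whose sign is unknown. -/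
theorem exponent_le {q s₁ s R c₁ c₂ e K L l n t : ℝ} (hq : 0 ≤ q) (hs₁ : 0 < s₁) (hs : s₁ ≤ s)
    (hR : 0 < R) (hc₁ : 0 ≤ c₁) (hc₂ : 0 ≤ c₂) (he : 2 ≤ e) (hl : c₂ + 1 ≤ l)
    (hn : n ≤ e * s * R + K * s) (hK : K * (2 * q) * l + K * c₂ ≤ 1 * R)
    (hL : |L| * (q + 1 / 2) * l + |L| * c₁ - s₁ * R ≤ t) :
    -(((q + 1 / 2) * l + c₁) * (L + 2 * e * s * R)) + n * (c₂ + 2 * q * l) ≤ t := by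
  have hs0 : 0 < s := hs₁.trans_le hs
  have hl0 : 0 ≤ l := by linarith
  have h2 : n * (c₂ + 2 * q * l) ≤ (e * s * R + K * s) * (c₂ + 2 * q * l) := by gcongr
  have h3 : -(|L| * ((q + 1 / 2) * l + c₁)) ≤ ((q + 1 / 2) * l + c₁) * L := by
    have h4 : 0 ≤ (q + 1 / 2) * l + c₁ := by positivity
    have h5 := mul_le_mul_of_nonneg_left (neg_abs_le L) h4
    linarith
  have h5 : s * (K * (2 * q) * l + K * c₂) ≤ s * (1 * R) := by gcongr
  have h6 : e * s * R * 1 ≤ e * s * R * (l - c₂) := by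
    gcongr
    linarith
  have h7 : 2 * (s * R) ≤ e * (s * R) := by gcongr
  have h8 : s₁ * R ≤ s * R := by gcongr
  have h9 : 0 ≤ c₁ * (2 * e * s * R) := by positivity
  have h10 : ((q + 1 / 2) * l + c₁) * (L + 2 * e * s * R) =
      ((q + 1 / 2) * l + c₁) * L + (2 * q) * (e * s * R * l) + e * s * R * l +
        c₁ * (2 * e * s * R) := by ring
  have h11 : (e * s * R + K * s) * (c₂ + 2 * q * l) =
      e * s * R * c₂ + (2 * q) * (e * s * R * l) + s * (K * (2 * q) * l + K * c₂) := by ring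
  have h12 : |L| * ((q + 1 / 2) * l + c₁) = |L| * (q + 1 / 2) * l + |L| * c₁ := by ring
  have h13 : e * s * R * (l - c₂) = e * s * R * l - e * s * R * c₂ := by ring
  linarith

/-- For `δ` as in the equation defining the radius, the set where the truncated transform is at
most `δ` has small measure. -/
theorem volume_small_set_le {φ : ℝ → ℂ} (hφ : Integrable φ volume) {q s₁ a : ℝ} (hq : 1 / 2 < q)
    (hs₁ : 0 < s₁) (ha : 0 < a) (x₀ : ℝ) :
    ∀ᶠ R : ℝ in atTop, ∀ s, s₁ ≤ s → a ≤ ‖truncHat φ s x₀‖ → ∀ δ : ℝ,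
      δ = Real.exp (-(((q + 1 / 2) * Real.log R + Real.log (15 * Real.exp 3)) *
        (Real.log (norm1 φ) + 2 * Real.exp 1 * s * R))) →
      volume {x : ℝ | |x| ≤ R ∧ ‖truncHat φ s x‖ ≤ δ} ≤ ENNReal.ofReal (R ^ (1 - 2 * q)) := by
  set N := norm1 φ with hN
  set c₀ := Real.log (4 * N / a) with hc₀
  set c₁ := Real.log (15 * Real.exp 3) with hc₁
  set c₂ := Real.log (16 * Real.exp 2) with hc₂
  set K := Real.exp 1 * |x₀| + (c₀ + 1) / s₁ with hK
  have he : 2 ≤ Real.exp 1 := by linarith [Real.add_one_le_exp (1 : ℝ)]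
  have hc₁0 : 0 ≤ c₁ := by
    refine Real.log_nonneg ?_
    nlinarith [Real.add_one_le_exp (3 : ℝ)]
  have hc₂0 : 0 ≤ c₂ := by
    refine Real.log_nonneg ?_
    nlinarith [Real.add_one_le_exp (2 : ℝ)]
  filter_upwards [eventually_ge_atTop 1, eventually_ge_atTop |x₀|,
    Real.tendsto_log_atTop.eventually_ge_atTop (c₂ + 1),
    eventually_log_add_le (K * (2 * q)) (K * c₂) one_pos,
    eventually_log_add_le (|Real.log N| * (q + 1 / 2)) (|Real.log N| * c₁ + Real.log (4 / a)) hs₁]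
    with R hR1 hRx hlog hKR hNR s hs hlow δ hδ
  by_contra! hvol
  have hs0 : 0 < s := hs₁.trans_le hs
  have hR0 : 0 < R := by linarith
  have haN : a ≤ N := by
    have := norm_truncHat_le hφ s x₀
    simp only [Complex.ofReal_im, abs_zero, mul_zero, Real.exp_zero, mul_one] at this
    exact hlow.trans this
  have hN0 : 0 < N := ha.trans_le haN
  have hc₀0 : 0 ≤ c₀ := by
    refine Real.log_nonneg ?_
    rw [le_div_iff₀ ha]
    linarith
  set R' := R + |x₀| with hR'
  have hR'0 : 0 < R' := by positivity
  have hR'2 : R' ≤ 2 * R := by linarith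
  set m := R ^ (1 - 2 * q) with hm
  have hm0 : 0 < m := Real.rpow_pos_of_pos hR0 _
  have hm1 : m ≤ 1 := Real.rpow_le_one_of_one_le_of_nonpos hR1 (by linarith)
  set E : Set ℝ := {x : ℝ | |x| ≤ R ∧ ‖truncHat φ s x‖ ≤ δ} with hE
  have hEcompact : IsCompact E := by
    refine (isCompact_Icc (a := -R) (b := R)).of_isClosed_subset ?_ fun x hx => abs_le.1 hx.1
    have hc : Continuous (truncHat φ s) := (differentiable_truncHat hφ s).continuous
    have h1 : IsClosed {x : ℝ | |x| ≤ R} := isClosed_le continuous_abs continuous_const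
    have h2 : IsClosed {x : ℝ | ‖truncHat φ s x‖ ≤ δ} :=
      isClosed_le (hc.comp Complex.continuous_ofReal).norm continuous_const
    exact h1.inter h2
  -- The Remez inequality concerns the value at the origin, so `x₀` is moved there, at the price of
  -- enlarging `R` to `R'`.
  set E' : Set ℝ := (fun y => y + x₀) ⁻¹' E with hE'
  have hE'compact : IsCompact E' :=
    (Homeomorph.addRight x₀).isCompact_preimage.2 hEcompact
  have hvol' : ENNReal.ofReal m ≤ volume E' := by
    rw [hE', measure_preimage_add_right]
    exact hvol.le
  -- Just large enough for e^(-n) to beat the growth e^(s e R') on the circle, with `c₀` to bring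
  -- the first term down to a/4.
  set n := ⌈s * (Real.exp 1 * R') + c₀⌉₊ with hn
  have hn1 : s * (Real.exp 1 * R') + c₀ ≤ n := Nat.le_ceil _
  have hn2 : (n : ℝ) < s * (Real.exp 1 * R') + c₀ + 1 := Nat.ceil_lt_add_one (by positivity)
  have hn0 : 0 < n := Nat.ceil_pos.2 (by positivity)
  have hmain := norm_apply_zero_le_of_small_on (f := fun z => truncHat φ s (z + x₀))
    ((differentiable_truncHat hφ s).comp (by fun_prop)) (M := N * Real.exp (s * (Real.exp 1 * R')))
    (δ := δ) hR'0 hm0 (by linarith [abs_nonneg x₀]) hE'compact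
    (fun x hx => by
      have h1 : |x + x₀| ≤ R := hx.1
      have h2 := abs_add_le (x + x₀) (-x₀)
      rw [add_neg_cancel_right, abs_neg] at h2
      linarith) hvol'
    (fun z hz => by
      refine (norm_truncHat_le hφ s _).trans ?_
      gcongr
      rw [Complex.add_im, Complex.ofReal_im, add_zero, ← hz]
      exact Complex.abs_im_le_norm z)
    (fun x hx => by
      have h1 : ‖truncHat φ s ((x + x₀ : ℝ) : ℂ)‖ ≤ δ := hx.2
      rwa [Complex.ofReal_add] at h1) hn0
  simp only [zero_add] at hmain
  have hfirst : N * Real.exp (s * (Real.exp 1 * R')) * Real.exp (-n) ≤ a / 4 := by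
    rw [mul_assoc, ← Real.exp_add]
    have h1 : Real.exp (s * (Real.exp 1 * R') + -n) ≤ Real.exp (-c₀) :=
      Real.exp_le_exp.2 (by linarith)
    rw [Real.exp_neg, hc₀, Real.exp_log (by positivity)] at h1
    calc _ ≤ N * (4 * N / a)⁻¹ := by gcongr
      _ = a / 4 := by field_simp
  -- With R' ≤ 2R and m = R^(1-2q) the base is at most 16e²R^(2q).
  have hQ : (8 * Real.exp 2 * R' / m) ^ n ≤ Real.exp (n * (c₂ + 2 * q * Real.log R)) := by
    rw [Real.exp_nat_mul]
    gcongr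
    rw [Real.exp_add, hc₂, Real.exp_log (by positivity), mul_comm (2 * q),
      ← Real.rpow_def_of_pos hR0, div_le_iff₀ hm0, hm, mul_assoc (16 * Real.exp 2),
      ← Real.rpow_add hR0]
    have : 2 * q + (1 - 2 * q) = 1 := by ring
    rw [this, Real.rpow_one]
    nlinarith [Real.exp_pos 2]
  have hexp : -(((q + 1 / 2) * Real.log R + c₁) *
      (Real.log N + 2 * Real.exp 1 * s * R)) + n * (c₂ + 2 * q * Real.log R) ≤
      Real.log (a / 4) := by
    have hnK : (n : ℝ) ≤ Real.exp 1 * s * R + K * s := by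
      have h1 : c₀ + 1 ≤ (c₀ + 1) / s₁ * s := by
        rw [div_mul_eq_mul_div, le_div_iff₀ hs₁]
        gcongr
      have h2 : K * s = Real.exp 1 * |x₀| * s + (c₀ + 1) / s₁ * s := by rw [hK]; ring
      rw [h2]
      have h3 : s * (Real.exp 1 * R') = Real.exp 1 * s * R + Real.exp 1 * |x₀| * s := by
        rw [hR']; ring
      linarith
    have h10 : Real.log (4 / a) = -Real.log (a / 4) := by
      rw [← Real.log_inv, inv_div]
    exact exponent_le (by linarith) hs₁ hs hR0 hc₁0 hc₂0 he hlog hnK hKR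
      (by rw [h10] at hNR; linarith)
  have hsecond : δ * (8 * Real.exp 2 * R' / m) ^ n ≤ a / 4 := by
    calc δ * (8 * Real.exp 2 * R' / m) ^ n
        ≤ δ * Real.exp (n * (c₂ + 2 * q * Real.log R)) := by
          gcongr
          rw [hδ]; positivity
      _ ≤ Real.exp (Real.log (a / 4)) := by
          rw [hδ, ← Real.exp_add]
          exact Real.exp_le_exp.2 hexp
      _ = a / 4 := Real.exp_log (by positivity)
  -- The Remez bound now reads a ≤ a/4 + 2·a/4, which is absurd.
  linarith

/-! ### Tails of φ and the cutoff s_ε -/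

/-- The mass of `φ` on `{|t| ≥ s}`. -/
noncomputable def tail (φ : ℝ → ℂ) (s : ℝ) : ℝ≥0∞ := ∫⁻ t in {t : ℝ | s ≤ |t|}, ‖φ t‖ₑ

theorem exp_neg_p (φ : ℝ → ℂ) (s : ℝ) : EReal.exp (-p φ s) = tail φ s := by
  rw [p, neg_neg, ENNReal.exp_log, tail]

theorem cutoff_eq (φ : ℝ → ℂ) (ε : ℝ) :
    cutoff φ ε = sInf {s : ℝ | 0 < s ∧ tail φ s ≤ ENNReal.ofReal ε} := by
  simp only [cutoff, exp_neg_p]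

theorem tail_anti (φ : ℝ → ℂ) : Antitone (tail φ) := fun _ _ hst =>
  lintegral_mono_set fun _ hx => hst.trans hx

theorem measurableSet_le_abs (s : ℝ) : MeasurableSet {t : ℝ | s ≤ |t|} :=
  measurableSet_le measurable_const measurable_id.abs

theorem cutoff_le {φ : ℝ → ℂ} {ε s : ℝ} (hs : 0 < s) (h : tail φ s ≤ ENNReal.ofReal ε) :
    cutoff φ ε ≤ s := by
  rw [cutoff_eq]
  exact csInf_le ⟨0, fun x hx => hx.1.le⟩ ⟨hs, h⟩

theorem tail_le_exp {φ : ℝ → ℂ}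
    (hp : Tendsto (fun s : ℝ => p φ s / (s : EReal)) atTop (𝓝 ⊤)) (K : ℝ) :
    ∀ᶠ s : ℝ in atTop, tail φ s ≤ ENNReal.ofReal (Real.exp (-(K * s))) := by
  have h1 : ∀ᶠ s : ℝ in atTop, (K : EReal) < p φ s / (s : EReal) :=
    hp.eventually (lt_mem_nhds (EReal.coe_lt_top K))
  filter_upwards [h1, eventually_gt_atTop 0] with s hs hs0
  have h2 : (K : EReal) * s ≤ p φ s :=
    (EReal.le_div_iff_mul_le (by exact_mod_cast hs0) (EReal.coe_ne_top s)).1 hs.le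
  rw [← exp_neg_p, ← EReal.exp_coe]
  refine EReal.exp_le_exp_iff.2 ?_
  rw [EReal.coe_neg, EReal.coe_mul]
  exact EReal.neg_le_neg_iff.2 h2

theorem tail_ne_zero {φ : ℝ → ℂ} (hφ : Integrable φ volume) (h0 : ¬ φ =ᵐ[volume] 0) :
    ∃ s₁ > 0, tail φ s₁ ≠ 0 := by
  by_contra! hall
  apply h0
  have h1 : ∀ n : ℕ, ∀ᵐ t : ℝ, 1 / ((n : ℝ) + 1) ≤ |t| → φ t = 0 := by
    intro n
    have h2 := hall (1 / ((n : ℝ) + 1)) (by positivity)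
    rw [tail, lintegral_eq_zero_iff' hφ.1.enorm.restrict, EventuallyEq,
      ae_restrict_iff' (measurableSet_le_abs _)] at h2
    filter_upwards [h2] with t ht hle
    simpa using ht hle
  have h3 : ∀ᵐ t : ℝ, t ≠ 0 := by
    rw [ae_iff]; simp
  filter_upwards [ae_all_iff.2 h1, h3] with t ht ht0
  obtain ⟨n, hn⟩ := exists_nat_one_div_lt (abs_pos.2 ht0)
  exact ht n hn.le

theorem exists_cutoff_set_nonempty {φ : ℝ → ℂ}
    (hp : Tendsto (fun s : ℝ => p φ s / (s : EReal)) atTop (𝓝 ⊤)) {ε : ℝ} (hε : 0 < ε) :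
    {s : ℝ | 0 < s ∧ tail φ s ≤ ENNReal.ofReal ε}.Nonempty := by
  have h1 : ∀ᶠ s : ℝ in atTop, Real.exp (-(1 * s)) ≤ ε := by
    filter_upwards [eventually_ge_atTop (-Real.log ε)] with s hs
    rw [← Real.exp_log hε]
    exact Real.exp_le_exp.2 (by linarith)
  obtain ⟨s, hs⟩ := ((tail_le_exp hp 1).and (h1.and (eventually_gt_atTop 0))).exists
  exact ⟨s, hs.2.2, hs.1.trans (ENNReal.ofReal_le_ofReal hs.2.1)⟩

/-- Once `ε` is below a nonzero tail at `s₁`, no `s < s₁` is admissible. The bound makes the second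
factor of the radius equation grow at least at a fixed linear rate in `R`. -/
theorem exists_le_cutoff {φ : ℝ → ℂ} (hφ : Integrable φ volume) (h0 : ¬ φ =ᵐ[volume] 0)
    (hp : Tendsto (fun s : ℝ => p φ s / (s : EReal)) atTop (𝓝 ⊤)) :
    ∃ s₁ > 0, ∀ᶠ ε : ℝ in 𝓝[>] 0, s₁ ≤ cutoff φ ε := by
  obtain ⟨s₁, hs₁, hne⟩ := tail_ne_zero hφ h0
  refine ⟨s₁, hs₁, ?_⟩
  have h1 : ∀ᶠ ε : ℝ in 𝓝[>] 0, ENNReal.ofReal ε < tail φ s₁ := by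
    have : Tendsto (fun ε : ℝ => ENNReal.ofReal ε) (𝓝[>] 0) (𝓝 0) := by
      have h := ENNReal.continuous_ofReal.tendsto 0
      rw [ENNReal.ofReal_zero] at h
      exact h.mono_left nhdsWithin_le_nhds
    exact this.eventually (gt_mem_nhds (pos_iff_ne_zero.2 hne))
  filter_upwards [h1, self_mem_nhdsWithin] with ε hε hε0
  rw [cutoff_eq]
  refine le_csInf (exists_cutoff_set_nonempty hp hε0) fun s hs => ?_
  by_contra! hlt
  exact absurd ((tail_anti φ hlt.le).trans hs.2) (not_le.2 hε)

/-- The mass of `φ` beyond the cutoff is at most `ε`. -/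
theorem setIntegral_compl_cutoff_le {φ : ℝ → ℂ} (hφ : Integrable φ volume)
    (hp : Tendsto (fun s : ℝ => p φ s / (s : EReal)) atTop (𝓝 ⊤)) {ε : ℝ} (hε : 0 < ε) :
    ∫ t in (Set.Icc (-cutoff φ ε) (cutoff φ ε))ᶜ, ‖φ t‖ ≤ ε := by
  set c := cutoff φ ε with hc
  -- Only levels strictly above the infimum are known to be admissible; the open complement is
  -- exhausted by them, so attainment of the infimum is not needed.
  have hset : (Set.Icc (-c) c)ᶜ = ⋃ n : ℕ, {t : ℝ | c + 1 / ((n : ℝ) + 1) ≤ |t|} := by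
    ext t
    rw [Set.mem_compl_iff, Set.mem_Icc, ← abs_le, not_le, Set.mem_iUnion]
    constructor
    · intro h
      obtain ⟨n, hn⟩ := exists_nat_one_div_lt (sub_pos.2 h)
      exact ⟨n, by simp only [Set.mem_ofPred_eq]; linarith⟩
    · rintro ⟨n, hn⟩
      have : 0 < 1 / ((n : ℝ) + 1) := by positivity
      simp only [Set.mem_ofPred_eq] at hn
      linarith
  have htail : ∀ n : ℕ, tail φ (c + 1 / ((n : ℝ) + 1)) ≤ ENNReal.ofReal ε := by
    intro n
    have hpos : 0 < 1 / ((n : ℝ) + 1) := by positivity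
    obtain ⟨s, hs, hlt⟩ := exists_lt_of_csInf_lt (exists_cutoff_set_nonempty hp hε)
      (show sInf {s : ℝ | 0 < s ∧ tail φ s ≤ ENNReal.ofReal ε} < c + 1 / ((n : ℝ) + 1) by
        rw [← cutoff_eq]; linarith)
    exact (tail_anti φ hlt.le).trans hs.2
  have hl : ∫⁻ t in (Set.Icc (-c) c)ᶜ, ‖φ t‖ₑ ≤ ENNReal.ofReal ε := by
    rw [hset]
    have hmono : Monotone fun n : ℕ => {t : ℝ | c + 1 / ((n : ℝ) + 1) ≤ |t|} := by
      intro m n hmn t ht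
      simp only [Set.mem_ofPred_eq] at ht ⊢
      have : 1 / ((n : ℝ) + 1) ≤ 1 / ((m : ℝ) + 1) :=
        one_div_le_one_div_of_le (by positivity) (by gcongr)
      linarith
    rw [setLIntegral_iUnion_of_directed _ hmono.directed_le]
    exact iSup_le htail
  rw [integral_norm_eq_lintegral_enorm hφ.1.restrict]
  exact ENNReal.toReal_le_of_le_ofReal hε.le hl

theorem tendsto_log_inv : Tendsto (fun ε : ℝ => Real.log (1 / ε)) (𝓝[>] 0) atTop := by
  simp only [one_div]
  exact Real.tendsto_log_atTop.comp tendsto_inv_nhdsGT_zero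

/-- The cutoff is `o(log (1/ε))`. -/
theorem cutoff_le_mul_log {φ : ℝ → ℂ}
    (hp : Tendsto (fun s : ℝ => p φ s / (s : EReal)) atTop (𝓝 ⊤)) {c : ℝ} (hc : 0 < c) :
    ∀ᶠ ε : ℝ in 𝓝[>] 0, cutoff φ ε ≤ c * Real.log (1 / ε) := by
  have h1 : Tendsto (fun ε : ℝ => c * Real.log (1 / ε)) (𝓝[>] 0) atTop :=
    tendsto_log_inv.const_mul_atTop hc
  -- The exponential tail bound with rate 1/c, taken at s = c log(1/ε), is exactly `ε`.
  filter_upwards [h1.eventually (tail_le_exp hp (1 / c)), h1.eventually_gt_atTop 0,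
    self_mem_nhdsWithin] with ε h2 h3 h4
  refine cutoff_le h3 (h2.trans (le_of_eq ?_))
  have : -(1 / c * (c * Real.log (1 / ε))) = Real.log ε := by
    rw [one_div ε, Real.log_inv]
    field_simp
  rw [this, Real.exp_log h4]

theorem cutoff_le_of_compact {φ : ℝ → ℂ} (h : HasCompactSupp φ) :
    ∃ M : ℝ, ∀ ε : ℝ, cutoff φ ε ≤ M := by
  obtain ⟨A, hA⟩ := h
  refine ⟨|A| + 1, fun ε => cutoff_le (by positivity) ?_⟩
  have : tail φ (|A| + 1) = 0 := by
    rw [tail, setLIntegral_congr_fun_ae (g := fun _ => 0) (measurableSet_le_abs _)]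
    · simp
    · filter_upwards [hA] with t ht hle
      have h1 : |A| + 1 ≤ |t| := hle
      rw [ht (by linarith [le_abs_self A]), enorm_zero]
  rw [this]
  exact zero_le

/-! ### The equation for the radius and the growth of its solution -/

/-- For ε < 1 the sum lies between ε^β and 2ε^β. -/
theorem neg_log_rpow_add_bounds {β : ℝ} (hβ₀ : 0 < β) (hβ₁ : β < 1 / 3) :
    ∀ᶠ ε : ℝ in 𝓝[>] 0, β * Real.log (1 / ε) - Real.log 2 ≤ -Real.log (ε ^ β + ε) ∧
      -Real.log (ε ^ β + ε) ≤ β * Real.log (1 / ε) := by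
  filter_upwards [Ioo_mem_nhdsGT (zero_lt_one' ℝ)] with ε hε
  have hε0 : 0 < ε := hε.1
  have hpos : 0 < ε ^ β := Real.rpow_pos_of_pos hε0 _
  have hle : ε ≤ ε ^ β := by
    conv_lhs => rw [← Real.rpow_one ε]
    exact Real.rpow_le_rpow_of_exponent_ge hε0 hε.2.le (by linarith)
  have hlog : β * Real.log (1 / ε) = -Real.log (ε ^ β) := by
    rw [Real.log_rpow hε0, one_div, Real.log_inv]; ring
  rw [hlog]
  constructor
  · have h1 : Real.log (ε ^ β + ε) ≤ Real.log (2 * ε ^ β) :=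
      Real.log_le_log (by positivity) (by linarith)
    rw [Real.log_mul two_ne_zero hpos.ne'] at h1
    linarith
  · have h1 : Real.log (ε ^ β) ≤ Real.log (ε ^ β + ε) := Real.log_le_log hpos (by linarith)
    linarith

theorem three_le_log_mul_exp : 3 ≤ Real.log (15 * Real.exp 3) := by
  rw [Real.log_mul (by norm_num) (Real.exp_ne_zero _), Real.log_exp]
  linarith [Real.log_nonneg (show (1 : ℝ) ≤ 15 by norm_num)]

/-- On bounded ranges of `R` the left side of the equation for the radius is eventually smaller
than the right side. -/
theorem radius_equation_lt {φ : ℝ → ℂ} {q β : ℝ} (hq : 1 / 2 < q) (hβ₀ : 0 < β) (hβ₁ : β < 1 / 3)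
    (hφ : Integrable φ volume) (h0 : ¬ φ =ᵐ[volume] 0)
    (hp : Tendsto (fun s : ℝ => p φ s / (s : EReal)) atTop (𝓝 ⊤)) {T : ℝ} (hT : 1 ≤ T) :
    ∀ᶠ ε : ℝ in 𝓝[>] 0, ∀ R : ℝ, 0 < R → R ≤ T →
      0 < (q + 1 / 2) * Real.log R + Real.log (15 * Real.exp 3) →
      ((q + 1 / 2) * Real.log R + Real.log (15 * Real.exp 3)) *
        (Real.log (norm1 φ) + 2 * Real.exp 1 * cutoff φ ε * R) < -Real.log (ε ^ β + ε) := by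
  obtain ⟨s₁, hs₁, hcut⟩ := exists_le_cutoff hφ h0 hp
  set c₁ := Real.log (15 * Real.exp 3) with hc₁
  have hc₁3 : 3 ≤ c₁ := three_le_log_mul_exp
  set a := (q + 1 / 2) * Real.log T + c₁ with ha
  have ha0 : 0 < a := by
    have := Real.log_nonneg hT
    positivity
  set L := Real.log (norm1 φ) with hL
  -- With `s_ε` at most this multiple of log(1/ε), the main term of the left side is at most (β/2)
  -- log(1/ε), half of what the right side offers.
  have hc : 0 < β / (4 * Real.exp 1 * T * a) := by positivity
  filter_upwards [neg_log_rpow_add_bounds hβ₀ hβ₁, cutoff_le_mul_log hp hc, hcut,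
    (tendsto_log_inv.const_mul_atTop (half_pos hβ₀)).eventually_gt_atTop
      (a * |L| + Real.log 2)] with ε h1 h2 h3 h4 R hR hRT hA
  refine lt_of_lt_of_le ?_ h1.1
  have hs0 : 0 < cutoff φ ε := hs₁.trans_le h3
  have hAa : (q + 1 / 2) * Real.log R + c₁ ≤ a := by
    rw [ha]
    gcongr
  have hcl : 0 ≤ β / (4 * Real.exp 1 * T * a) * Real.log (1 / ε) := hs0.le.trans h2
  have hB : L + 2 * Real.exp 1 * cutoff φ ε * R ≤
      |L| + 2 * Real.exp 1 * (β / (4 * Real.exp 1 * T * a) * Real.log (1 / ε)) * T := by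
    refine add_le_add (le_abs_self L) (mul_le_mul ?_ hRT hR.le (by positivity))
    gcongr
  have hB0 : 0 ≤ |L| + 2 * Real.exp 1 * (β / (4 * Real.exp 1 * T * a) * Real.log (1 / ε)) * T := by
    positivity
  calc ((q + 1 / 2) * Real.log R + c₁) * (L + 2 * Real.exp 1 * cutoff φ ε * R)
      ≤ a * (|L| + 2 * Real.exp 1 * (β / (4 * Real.exp 1 * T * a) * Real.log (1 / ε)) * T) :=
        (mul_le_mul_of_nonneg_left hB hA.le).trans (mul_le_mul_of_nonneg_right hAa hB0)
    _ = a * |L| + β / 2 * Real.log (1 / ε) := by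
        field_simp
        ring
    _ < _ := by linarith

/-- Existence is the intermediate value theorem on [1, T]. For uniqueness, both factors are
increasing in `R` and positive at any solution. -/
theorem existsUnique_radius {φ : ℝ → ℂ} {q β : ℝ} (hq : 1 / 2 < q) (hβ₀ : 0 < β) (hβ₁ : β < 1 / 3)
    (hφ : Integrable φ volume) (h0 : ¬ φ =ᵐ[volume] 0)
    (hp : Tendsto (fun s : ℝ => p φ s / (s : EReal)) atTop (𝓝 ⊤)) :
    ∀ᶠ ε : ℝ in 𝓝[>] 0, ∃! R : ℝ, IsRadius φ q β ε R := by
  obtain ⟨s₁, hs₁, hcut⟩ := exists_le_cutoff hφ h0 hp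
  have hc₁3 : 3 ≤ Real.log (15 * Real.exp 3) := three_le_log_mul_exp
  filter_upwards [radius_equation_lt hq hβ₀ hβ₁ hφ h0 hp le_rfl, hcut,
    neg_log_rpow_add_bounds hβ₀ hβ₁, tendsto_log_inv.eventually_gt_atTop (Real.log 2 / β)]
    with ε h1 h2 h3 h4
  have hs0 : 0 < cutoff φ ε := hs₁.trans_le h2
  have hτ : 0 < -Real.log (ε ^ β + ε) := by
    rw [div_lt_iff₀ hβ₀] at h4
    linarith [h3.1]
  set c₁ := Real.log (15 * Real.exp 3) with hc₁
  set L := Real.log (norm1 φ) with hL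
  set F : ℝ → ℝ := fun R => ((q + 1 / 2) * Real.log R + c₁) *
    (L + 2 * Real.exp 1 * cutoff φ ε * R) with hF
  have hpos : 0 < 2 * Real.exp 1 * cutoff φ ε := by positivity
  have htop : Tendsto F atTop atTop := by
    refine Tendsto.atTop_mul_atTop₀ ?_ ?_
    · exact tendsto_atTop_add_const_right _ _
        (Real.tendsto_log_atTop.const_mul_atTop (by linarith))
    · exact tendsto_atTop_add_const_left _ _ (tendsto_id.const_mul_atTop hpos)
  obtain ⟨T, hT1, hT⟩ := ((eventually_ge_atTop 1).and
    (htop.eventually_ge_atTop (-Real.log (ε ^ β + ε)))).exists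
  have hcont : ContinuousOn F (Set.Icc 1 T) := by
    have : ContinuousOn Real.log (Set.Icc 1 T) :=
      Real.continuousOn_log.mono fun x hx => by
        simp only [Set.mem_compl_iff, Set.mem_singleton_iff]
        linarith [hx.1]
    fun_prop
  have hF1 : F 1 ≤ -Real.log (ε ^ β + ε) := by
    refine (h1 1 one_pos le_rfl ?_).le
    rw [Real.log_one]
    linarith
  obtain ⟨R, hR, hFR⟩ := intermediate_value_Icc hT1 hcont ⟨hF1, hT⟩
  have hstrict : ∀ R₁ R₂ : ℝ, IsRadius φ q β ε R₁ → IsRadius φ q β ε R₂ → ¬ R₁ < R₂ := by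
    intro R₁ R₂ k₁ k₂ hlt
    obtain ⟨p₁, a₁, e₁⟩ := k₁
    obtain ⟨p₂, a₂, e₂⟩ := k₂
    have hb₁ := hτ
    rw [← e₁] at hb₁
    -- The right side and the first factor are positive, hence so is the second factor at `R₁`.
    have hb₁ := (mul_pos_iff_of_pos_left a₁).1 hb₁
    have : F R₁ < F R₂ := by
      refine mul_lt_mul'' ?_ ?_ a₁.le hb₁.le
      · have := Real.log_lt_log p₁ hlt
        gcongr
      · gcongr
    exact absurd (e₁.trans e₂.symm) this.ne
  have hRrad : IsRadius φ q β ε R := by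
    refine ⟨by linarith [hR.1], ?_, hFR⟩
    have := Real.log_nonneg hR.1
    positivity
  refine ⟨R, hRrad, fun R' hR' => ?_⟩
  exact le_antisymm (not_lt.1 (hstrict R R' hRrad hR')) (not_lt.1 (hstrict R' R hR' hRrad))

theorem tendsto_radius {φ : ℝ → ℂ} {q β : ℝ} (hq : 1 / 2 < q) (hβ₀ : 0 < β) (hβ₁ : β < 1 / 3)
    (hφ : Integrable φ volume) (h0 : ¬ φ =ᵐ[volume] 0)
    (hp : Tendsto (fun s : ℝ => p φ s / (s : EReal)) atTop (𝓝 ⊤)) {R : ℝ → ℝ}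
    (hR : ∀ᶠ ε : ℝ in 𝓝[>] 0, IsRadius φ q β ε (R ε)) :
    Tendsto R (𝓝[>] 0) atTop := by
  rw [tendsto_atTop]
  intro T
  filter_upwards [hR, radius_equation_lt hq hβ₀ hβ₁ hφ h0 hp (le_max_right T 1)] with ε h1 h2
  by_contra! hlt
  exact (h2 (R ε) h1.1 (hlt.le.trans (le_max_left _ _)) h1.2.1).ne h1.2.2

/-- For large `R` the first factor is at least 1, and the second at least e s₁ R: half of 2e s₁ R
absorbs a possibly negative log ‖φ‖₁. -/
theorem radius_le_log {φ : ℝ → ℂ} {q β : ℝ} (hq : 1 / 2 < q) (hβ₀ : 0 < β) (hβ₁ : β < 1 / 3)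
    (hφ : Integrable φ volume) (h0 : ¬ φ =ᵐ[volume] 0)
    (hp : Tendsto (fun s : ℝ => p φ s / (s : EReal)) atTop (𝓝 ⊤)) {R : ℝ → ℝ}
    (hR : ∀ᶠ ε : ℝ in 𝓝[>] 0, IsRadius φ q β ε (R ε)) :
    ∃ K > 0, ∀ᶠ ε : ℝ in 𝓝[>] 0, R ε ≤ K * Real.log (1 / ε) := by
  obtain ⟨s₁, hs₁, hcut⟩ := exists_le_cutoff hφ h0 hp
  have hRtop := tendsto_radius hq hβ₀ hβ₁ hφ h0 hp hR
  refine ⟨β / (Real.exp 1 * s₁), by positivity, ?_⟩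
  have h5 := (hRtop.const_mul_atTop (show 0 < Real.exp 1 * s₁ by positivity)).eventually_ge_atTop
    (-Real.log (norm1 φ))
  filter_upwards [hR, hcut, neg_log_rpow_add_bounds hβ₀ hβ₁, hRtop.eventually_ge_atTop 1, h5]
    with ε h1 h2 h3 h4 h5
  have hA : 1 ≤ (q + 1 / 2) * Real.log (R ε) + Real.log (15 * Real.exp 3) := by
    have h6 := Real.log_nonneg h4
    have h7 : 0 ≤ (q + 1 / 2) * Real.log (R ε) := by positivity
    linarith [three_le_log_mul_exp]
  have hB : Real.exp 1 * s₁ * R ε ≤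
      Real.log (norm1 φ) + 2 * Real.exp 1 * cutoff φ ε * R ε := by
    have : 2 * Real.exp 1 * s₁ * R ε ≤ 2 * Real.exp 1 * cutoff φ ε * R ε := by gcongr
    linarith
  have hB0 : 0 ≤ Real.exp 1 * s₁ * R ε := by positivity
  have h8 : Real.exp 1 * s₁ * R ε ≤ β * Real.log (1 / ε) := by
    refine le_trans ?_ h3.2
    rw [← h1.2.2]
    nlinarith
  rw [div_mul_eq_mul_div, le_div_iff₀ (by positivity)]
  linarith

theorem eventually_log_add_le_rpow (a b : ℝ) {η : ℝ} (hη : 0 < η) :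
    ∀ᶠ R : ℝ in atTop, a * Real.log R + b ≤ R ^ η := by
  filter_upwards [(tendsto_rpow_atTop hη).eventually (eventually_log_add_le (a / η) b one_pos),
    eventually_gt_atTop 0] with R h1 h2
  rw [Real.log_rpow h2, one_mul] at h1
  calc a * Real.log R + b = a / η * (η * Real.log R) + b := by field_simp
    _ ≤ _ := h1

/-- The upper bound comes from `radius_le_log`. For the lower one, a bounded cutoff makes the left
side of the equation O(R log R), hence at most R^(1+η), while the right side is at least (β/2)
log(1/ε). -/
theorem tendsto_log_radius_div {φ : ℝ → ℂ} {q β : ℝ} (hq : 1 / 2 < q) (hβ₀ : 0 < β)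
    (hβ₁ : β < 1 / 3) (hφ : Integrable φ volume) (h0 : ¬ φ =ᵐ[volume] 0)
    (hp : Tendsto (fun s : ℝ => p φ s / (s : EReal)) atTop (𝓝 ⊤)) {R : ℝ → ℝ}
    (hR : ∀ᶠ ε : ℝ in 𝓝[>] 0, IsRadius φ q β ε (R ε)) {M : ℝ} (hM : ∀ ε, cutoff φ ε ≤ M) :
    Tendsto (fun ε : ℝ => Real.log (R ε) / Real.log (Real.log (1 / ε))) (𝓝[>] 0) (𝓝 1) := by
  obtain ⟨s₁, hs₁, hcut⟩ := exists_le_cutoff hφ h0 hp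
  obtain ⟨K, hK, hRK⟩ := radius_le_log hq hβ₀ hβ₁ hφ h0 hp hR
  have hRtop := tendsto_radius hq hβ₀ hβ₁ hφ h0 hp hR
  have hll : Tendsto (fun ε : ℝ => Real.log (Real.log (1 / ε))) (𝓝[>] 0) atTop :=
    Real.tendsto_log_atTop.comp tendsto_log_inv
  set L := Real.log (norm1 φ) with hL
  set c₁ := Real.log (15 * Real.exp 3) with hc₁
  set D := |L| + 2 * Real.exp 1 * |M| with hD
  have hD0 : 0 ≤ D := by positivity
  rw [Metric.tendsto_nhds]
  intro η' hη'
  set η := η' / 2 with hη_def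
  have hη : 0 < η := by positivity
  filter_upwards [hR, hRK, hcut, neg_log_rpow_add_bounds hβ₀ hβ₁, hRtop.eventually_ge_atTop 1,
    hll.eventually_gt_atTop 0, tendsto_log_inv.eventually_gt_atTop 0,
    (tendsto_log_inv.const_mul_atTop (half_pos hβ₀)).eventually_ge_atTop (Real.log 2),
    (hll.const_mul_atTop hη).eventually_ge_atTop (Real.log K),
    -- Since (1+η)(1-η) = 1 - η², the slack available for the constant log(β/2) is η² log log(1/ε).
    (hll.const_mul_atTop (show 0 < η * η by positivity)).eventually_ge_atTop (-Real.log (β / 2)),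
    hRtop.eventually (eventually_log_add_le_rpow (D * (q + 1 / 2)) (D * c₁) hη)]
    with ε h1 h2 h3 h4 h5 h6 h7 h8 h9 h10 h11
  set l := Real.log (1 / ε) with hl
  have hR0 : 0 < R ε := h1.1
  have hupper : Real.log (R ε) ≤ (1 + η) * Real.log l := by
    have := Real.log_le_log hR0 h2
    rw [Real.log_mul hK.ne' h7.ne'] at this
    linarith
  have hlower : Real.log l + Real.log (β / 2) ≤ (1 + η) * Real.log (R ε) := by
    rw [← Real.log_mul h7.ne' (by positivity), ← Real.log_rpow hR0]
    refine Real.log_le_log (by positivity) ?_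
    have hB : L + 2 * Real.exp 1 * cutoff φ ε * R ε ≤ D * R ε := by
      have e1 : 2 * Real.exp 1 * cutoff φ ε * R ε ≤ 2 * Real.exp 1 * |M| * R ε := by
        gcongr
        exact (hM ε).trans (le_abs_self M)
      have e2 : |L| * 1 ≤ |L| * R ε := by gcongr
      rw [hD]
      linarith [le_abs_self L]
    calc l * (β / 2) ≤ β * l - Real.log 2 := by linarith
      _ ≤ -Real.log (ε ^ β + ε) := h4.1
      _ = _ := h1.2.2.symm
      _ ≤ ((q + 1 / 2) * Real.log (R ε) + c₁) * (D * R ε) := by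
          gcongr
          exact h1.2.1.le
      _ = (D * (q + 1 / 2) * Real.log (R ε) + D * c₁) * R ε := by ring
      _ ≤ R ε ^ η * R ε := by gcongr
      _ = R ε ^ (1 + η) := by
          rw [Real.rpow_add hR0, Real.rpow_one, mul_comm]
  have hlow' : (1 - η) * Real.log l ≤ Real.log (R ε) := by
    have h12 : (1 + η) * ((1 - η) * Real.log l) ≤ (1 + η) * Real.log (R ε) := by
      have : (1 + η) * ((1 - η) * Real.log l) = Real.log l - η * η * Real.log l := by ring
      linarith
    exact le_of_mul_le_mul_left h12 (by positivity)
  have u1 : Real.log (R ε) / Real.log l ≤ 1 + η := (div_le_iff₀ h6).2 hupper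
  have u2 : 1 - η ≤ Real.log (R ε) / Real.log l := (le_div_iff₀ h6).2 hlow'
  rw [Real.dist_eq, abs_lt]
  constructor <;> linarith

/-! ### L² mass on high frequencies and on small sets -/

theorem lintegral_Ioi_rpow {q R : ℝ} (hq : 1 / 2 < q) (hR : 0 < R) :
    ∫⁻ x in Set.Ioi R, ENNReal.ofReal (|x| ^ (-(2 * q))) =
      ENNReal.ofReal (R ^ (1 - 2 * q) / (2 * q - 1)) := by
  have h1 : ∫⁻ x in Set.Ioi R, ENNReal.ofReal (|x| ^ (-(2 * q))) =
      ∫⁻ x in Set.Ioi R, ENNReal.ofReal (x ^ (-(2 * q))) := by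
    refine setLIntegral_congr_fun measurableSet_Ioi fun x hx => ?_
    have hx0 : 0 < x := hR.trans hx
    simp only [abs_of_pos hx0]
  rw [h1, ← ofReal_integral_eq_lintegral_ofReal
    (integrableOn_Ioi_rpow_of_lt (by linarith) hR), integral_Ioi_rpow_of_lt (by linarith) hR]
  · congr 1
    have h2 : -(2 * q) + 1 = 1 - 2 * q := by ring
    have h3 : 1 - 2 * q ≠ 0 := by linarith
    have h4 : 2 * q - 1 ≠ 0 := by linarith
    rw [h2, div_eq_div_iff h3 h4]
    ring
  · rw [EventuallyLE, ae_restrict_iff' measurableSet_Ioi]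
    exact Eventually.of_forall fun x hx => Real.rpow_nonneg (hR.trans hx).le _

theorem lintegral_abs_gt_rpow_le {q R : ℝ} (hq : 1 / 2 < q) (hR : 0 < R) :
    ∫⁻ x in {x : ℝ | R < |x|}, ENNReal.ofReal (|x| ^ (-(2 * q))) ≤
      ENNReal.ofReal (2 * (R ^ (1 - 2 * q) / (2 * q - 1))) := by
  have hset : {x : ℝ | R < |x|} = Set.Ioi R ∪ Set.Iio (-R) := by
    ext x
    simp only [Set.mem_ofPred_eq, Set.mem_union, Set.mem_Ioi, Set.mem_Iio, lt_abs, lt_neg]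
  have hneg : ∫⁻ x in Set.Iio (-R), ENNReal.ofReal (|x| ^ (-(2 * q))) =
      ∫⁻ x in Set.Ioi R, ENNReal.ofReal (|x| ^ (-(2 * q))) := by
    rw [← lintegral_indicator measurableSet_Iio, ← lintegral_indicator measurableSet_Ioi,
      ← lintegral_neg_eq_self]
    congr 1
    ext x
    simp only [Set.indicator_apply, Set.mem_Iio, Set.mem_Ioi, neg_lt_neg_iff, abs_neg]
  rw [hset]
  refine (lintegral_union_le _ _ _).trans (le_of_eq ?_)
  have hnn : 0 ≤ R ^ (1 - 2 * q) / (2 * q - 1) :=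
    div_nonneg (Real.rpow_nonneg hR.le _) (by linarith)
  rw [hneg, lintegral_Ioi_rpow hq hR, ← ENNReal.ofReal_add hnn hnn,
    two_mul (R ^ (1 - 2 * q) / (2 * q - 1))]

theorem ae_comp_mul_left {P : ℝ → Prop} {c : ℝ} (hc : c ≠ 0) (h : ∀ᵐ x : ℝ, P x) :
    ∀ᵐ y : ℝ, P (c * y) := by
  have hq : Measure.QuasiMeasurePreserving (fun y : ℝ => c * y) volume volume := by
    refine ⟨measurable_const_mul c, ?_⟩
    rw [Real.map_volume_mul_left hc]
    exact Measure.smul_absolutelyContinuous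
  exact hq.ae h

theorem one_le_two_pi : 1 ≤ 2 * Real.pi := by linarith [Real.pi_gt_three]

theorem hat2_two_pi_mul (f : L2) (y : ℝ) : hat2 f (2 * Real.pi * y) = (𝓕 f : L2) y := by
  unfold hat2
  rw [mul_div_cancel_left₀ y (by positivity)]

theorem volume_preimage_two_pi_le (E : Set ℝ) :
    volume ((fun y : ℝ => 2 * Real.pi * y) ⁻¹' E) ≤ volume E := by
  rw [Real.volume_preimage_mul_left (by positivity)]
  have h1 : ENNReal.ofReal |(2 * Real.pi)⁻¹| ≤ 1 := by
    rw [ENNReal.ofReal_le_one, abs_of_pos (by positivity)]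
    exact inv_le_one_of_one_le₀ one_le_two_pi
  calc _ ≤ 1 * volume E := by gcongr
    _ = _ := one_mul _

/-- The `L²` norm, on the frequencies beyond `R` and on a small set, of a function with the
prescribed decay. -/
theorem eLpNorm_indicator_le {u : ℝ → ℂ} {C q R : ℝ} (hq : 1 / 2 < q) (hR : 0 < R)
    (hu : ∀ᵐ x : ℝ, ‖u x‖ ^ 2 ≤ C * (1 + (2 * Real.pi * x) ^ 2) ^ (-q))
    {E : Set ℝ} (hE : MeasurableSet E) (hvol : volume E ≤ ENNReal.ofReal (R ^ (1 - 2 * q))) :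
    eLpNorm (((fun y : ℝ => 2 * Real.pi * y) ⁻¹' ({x : ℝ | R < |x|} ∪ E)).indicator u) 2 volume ≤
      ENNReal.ofReal (√(|C| * (2 / (2 * q - 1) + 1)) * R ^ (-q + 1 / 2)) := by
  have hq0 : 0 < 2 * q - 1 := by linarith
  set T : Set ℝ := {x : ℝ | R < |x|} with hT
  have hTm : MeasurableSet T := measurableSet_lt measurable_const measurable_id.abs
  set m : ℝ → ℝ := fun y => 2 * Real.pi * y with hm
  have hmm : Measurable m := measurable_const_mul _
  have hS : MeasurableSet (m ⁻¹' (T ∪ E)) := hmm (hTm.union hE)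
  have hbound : ∀ᵐ y : ℝ, ‖u y‖ₑ ^ (2 : ℝ) ≤
      ENNReal.ofReal (|C| * (1 + (m y) ^ 2) ^ (-q)) := by
    filter_upwards [hu] with y hy
    rw [← ofReal_norm, ENNReal.ofReal_rpow_of_nonneg (norm_nonneg _) zero_le_two]
    refine ENNReal.ofReal_le_ofReal ?_
    rw [Real.rpow_two]
    refine hy.trans ?_
    gcongr
    exact le_abs_self C
  have hfar : ∫⁻ y in m ⁻¹' T, ‖u y‖ₑ ^ (2 : ℝ) ≤
      ENNReal.ofReal |C| * ENNReal.ofReal (2 * (R ^ (1 - 2 * q) / (2 * q - 1))) := by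
    set H : ℝ → ℝ≥0∞ := T.indicator fun x => ENNReal.ofReal (|x| ^ (-(2 * q))) with hH
    have hHm : Measurable H := by
      refine Measurable.indicator ?_ hTm
      exact (measurable_id.abs.pow_const _).ennreal_ofReal
    calc ∫⁻ y in m ⁻¹' T, ‖u y‖ₑ ^ (2 : ℝ)
        = ∫⁻ y, (m ⁻¹' T).indicator (fun y => ‖u y‖ₑ ^ (2 : ℝ)) y :=
          (lintegral_indicator (hmm hTm) _).symm
      _ ≤ ∫⁻ y, ENNReal.ofReal |C| * H (m y) := by
          refine lintegral_mono_ae ?_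
          filter_upwards [hbound] with y hy
          by_cases hyT : y ∈ m ⁻¹' T
          · have hyT' : m y ∈ T := hyT
            have hRy : R < |m y| := hyT'
            rw [Set.indicator_of_mem hyT, hH, Set.indicator_of_mem hyT',
              ← ENNReal.ofReal_mul (abs_nonneg C)]
            refine hy.trans (ENNReal.ofReal_le_ofReal ?_)
            have h0 : 0 < |m y| := hR.trans hRy
            gcongr
            have h1 : |m y| ^ (-(2 * q)) = (|m y| ^ 2) ^ (-q) := by
              rw [← Real.rpow_two, ← Real.rpow_mul h0.le]
              ring_nf
            rw [h1]
            refine Real.rpow_le_rpow_of_nonpos (by positivity) ?_ (by linarith)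
            rw [sq_abs]
            linarith
          · rw [Set.indicator_of_notMem hyT]
            exact zero_le
      _ = ENNReal.ofReal |C| * ∫⁻ y, H (m y) := lintegral_const_mul _ (hHm.comp hmm)
      _ = ENNReal.ofReal |C| * ∫⁻ x, H x ∂(Measure.map m volume) := by
          rw [lintegral_map hHm hmm]
      _ ≤ ENNReal.ofReal |C| * ∫⁻ x, H x := by
          refine mul_le_mul_right ?_ _
          -- The change of variable by 2π only contributes the factor 1/(2π) ≤ 1.
          rw [hm, Real.map_volume_mul_left (by positivity), lintegral_smul_measure]
          have h1 : ENNReal.ofReal |(2 * Real.pi)⁻¹| ≤ 1 := by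
            rw [ENNReal.ofReal_le_one, abs_of_pos (by positivity)]
            exact inv_le_one_of_one_le₀ one_le_two_pi
          refine (mul_le_mul_left h1 _).trans (le_of_eq ?_)
          exact one_mul _
      _ ≤ _ := by
          gcongr
          rw [hH, lintegral_indicator hTm]
          exact lintegral_abs_gt_rpow_le hq hR
  have hnear : ∫⁻ y in m ⁻¹' E, ‖u y‖ₑ ^ (2 : ℝ) ≤
      ENNReal.ofReal |C| * ENNReal.ofReal (R ^ (1 - 2 * q)) := by
    calc ∫⁻ y in m ⁻¹' E, ‖u y‖ₑ ^ (2 : ℝ) ≤ ∫⁻ _y in m ⁻¹' E, ENNReal.ofReal |C| := by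
          refine lintegral_mono_ae (ae_restrict_of_ae ?_)
          filter_upwards [hbound] with y hy
          refine hy.trans (ENNReal.ofReal_le_ofReal ?_)
          refine mul_le_of_le_one_right (abs_nonneg C) ?_
          exact Real.rpow_le_one_of_one_le_of_nonpos (by nlinarith [sq_nonneg (m y)]) (by linarith)
      _ = ENNReal.ofReal |C| * volume (m ⁻¹' E) := by rw [setLIntegral_const]
      _ ≤ _ := by
          gcongr
          exact (volume_preimage_two_pi_le E).trans hvol
  have hR' : 0 ≤ R ^ (1 - 2 * q) := Real.rpow_nonneg hR.le _
  rw [eLpNorm_indicator_eq_eLpNorm_restrict hS,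
    eLpNorm_eq_lintegral_rpow_enorm_toReal two_ne_zero ENNReal.ofNat_ne_top, ENNReal.toReal_ofNat]
  have htotal : ∫⁻ y in m ⁻¹' (T ∪ E), ‖u y‖ₑ ^ (2 : ℝ) ≤
      ENNReal.ofReal (|C| * (2 / (2 * q - 1) + 1) * R ^ (1 - 2 * q)) := by
    rw [Set.preimage_union]
    refine (lintegral_union_le _ _ _).trans ((add_le_add hfar hnear).trans (le_of_eq ?_))
    rw [← ENNReal.ofReal_mul (abs_nonneg C), ← ENNReal.ofReal_mul (abs_nonneg C),
      ← ENNReal.ofReal_add (by positivity) (by positivity)]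
    congr 1
    ring
  refine (ENNReal.rpow_le_rpow htotal (by norm_num)).trans (le_of_eq ?_)
  rw [ENNReal.ofReal_rpow_of_nonneg (by positivity) (by norm_num),
    Real.mul_rpow (by positivity) hR', ← Real.rpow_mul hR.le, Real.sqrt_eq_rpow]
  congr 3
  ring

/-! ### Error of the Tikhonov approximation -/

theorem norm_sub_le_of_pointwise {U V G : L2} {S : Set ℝ} (hS : MeasurableSet S)
    {κ₁ κ₂ t : ℝ} (hκ₁ : 0 ≤ κ₁) (hκ₂ : 0 ≤ κ₂) (ht : 0 ≤ t)
    (hind : eLpNorm (S.indicator U) 2 volume ≤ ENNReal.ofReal t)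
    (h : ∀ᵐ y : ℝ, ‖U y - V y‖ ≤ ‖S.indicator U y‖ + (κ₁ * ‖U y‖ + κ₂ * ‖G y‖)) :
    ‖U - V‖ ≤ t + (κ₁ * ‖U‖ + κ₂ * ‖G‖) := by
  have hU := Lp.aestronglyMeasurable U
  have hG := Lp.aestronglyMeasurable G
  have hscale : ∀ (κ : ℝ) (W : L2), 0 ≤ κ →
      eLpNorm (fun y => κ * ‖W y‖) 2 volume = ENNReal.ofReal (κ * ‖W‖) := by
    intro κ W hκ
    have h1 : (fun y => κ * ‖W y‖) = κ • fun y => ‖W y‖ := by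
      ext y; simp
    rw [h1, eLpNorm_const_smul, eLpNorm_norm, Lp.norm_def, ENNReal.ofReal_mul hκ,
      ENNReal.ofReal_toReal (Lp.eLpNorm_ne_top W), Real.enorm_of_nonneg hκ]
  have hmain : eLpNorm (fun y => U y - V y) 2 volume ≤
      ENNReal.ofReal (t + (κ₁ * ‖U‖ + κ₂ * ‖G‖)) := by
    calc eLpNorm (fun y => U y - V y) 2 volume
        ≤ eLpNorm ((fun y => ‖S.indicator U y‖) +
            ((fun y => κ₁ * ‖U y‖) + fun y => κ₂ * ‖G y‖)) 2 volume :=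
          eLpNorm_mono_ae_real h
      _ ≤ eLpNorm (fun y => ‖S.indicator U y‖) 2 volume +
            (eLpNorm (fun y => κ₁ * ‖U y‖) 2 volume + eLpNorm (fun y => κ₂ * ‖G y‖) 2 volume) := by
          have m1 : AEStronglyMeasurable (fun y => κ₁ * ‖U y‖) volume := hU.norm.const_mul _
          have m2 : AEStronglyMeasurable (fun y => κ₂ * ‖G y‖) volume := hG.norm.const_mul _
          refine (eLpNorm_add_le (hU.indicator hS).norm (m1.add m2) one_le_two).trans ?_
          gcongr
          exact eLpNorm_add_le m1 m2 one_le_two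
      _ ≤ ENNReal.ofReal t + (ENNReal.ofReal (κ₁ * ‖U‖) + ENNReal.ofReal (κ₂ * ‖G‖)) := by
          rw [hscale _ _ hκ₁, hscale _ _ hκ₂, eLpNorm_norm]
          gcongr
      _ = _ := by
          rw [ENNReal.ofReal_add ht (by positivity),
            ENNReal.ofReal_add (by positivity) (by positivity)]
  rw [Lp.norm_def]
  refine ENNReal.toReal_le_of_le_ofReal (by positivity) ?_
  rw [eLpNorm_congr_ae (Lp.coeFn_sub U V)]
  exact hmain

/-- The pointwise error of the Tikhonov quotient. -/
theorem norm_sub_tikhonov_le {a b u G : ℂ} {δ ε : ℝ} (hδ : 0 < δ) (hab : ‖a - b‖ ≤ ε) :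
    ‖u - G * (starRingEnd ℂ) b / ((δ + ‖b‖ ^ 2 : ℝ) : ℂ)‖ ≤
      δ / (δ + ‖b‖ ^ 2) * ‖u‖ + (ε * ‖u‖ + ‖G - a * u‖) / (2 * √δ) := by
  have hD : 0 < δ + ‖b‖ ^ 2 := by positivity
  have hDC : ((δ + ‖b‖ ^ 2 : ℝ) : ℂ) ≠ 0 := by exact_mod_cast hD.ne'
  have hbb : ((‖b‖ ^ 2 : ℝ) : ℂ) = b * (starRingEnd ℂ) b := by
    rw [Complex.mul_conj, Complex.normSq_eq_norm_sq]
  have hs : 0 < √δ := Real.sqrt_pos.2 hδ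
  have hkey : u - G * (starRingEnd ℂ) b / ((δ + ‖b‖ ^ 2 : ℝ) : ℂ) =
      (δ * u - ((a - b) * u + (G - a * u)) * (starRingEnd ℂ) b) /
        ((δ + ‖b‖ ^ 2 : ℝ) : ℂ) := by
    rw [eq_div_iff hDC, sub_mul, div_mul_cancel₀ _ hDC, Complex.ofReal_add, hbb]
    ring
  rw [hkey, norm_div, Complex.norm_real, Real.norm_of_nonneg hD.le, div_le_iff₀ hD]
  have hnum : ‖δ * u - ((a - b) * u + (G - a * u)) * (starRingEnd ℂ) b‖ ≤
      δ * ‖u‖ + (ε * ‖u‖ + ‖G - a * u‖) * ‖b‖ := by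
    refine (norm_sub_le _ _).trans ?_
    rw [norm_mul, norm_mul, RCLike.norm_conj, Complex.norm_real, Real.norm_of_nonneg hδ.le]
    gcongr
    refine (norm_add_le _ _).trans ?_
    rw [norm_mul]
    gcongr
  refine hnum.trans ?_
  have hX : 0 ≤ ε * ‖u‖ + ‖G - a * u‖ := by
    have := (norm_nonneg _).trans hab
    positivity
  -- Arithmetic-geometric mean: 2√δ|b| ≤ δ + |b|². This is the noise amplification of the
  -- regularised inverse.
  have hb : ‖b‖ ≤ (δ + ‖b‖ ^ 2) / (2 * √δ) := by
    rw [le_div_iff₀ (by positivity)]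
    nlinarith [sq_nonneg (√δ - ‖b‖), Real.sq_sqrt hδ.le]
  have hsplit : (δ / (δ + ‖b‖ ^ 2) * ‖u‖ + (ε * ‖u‖ + ‖G - a * u‖) / (2 * √δ)) * (δ + ‖b‖ ^ 2) =
      δ * ‖u‖ + (ε * ‖u‖ + ‖G - a * u‖) * ((δ + ‖b‖ ^ 2) / (2 * √δ)) := by
    field_simp
  rw [hsplit]
  have := mul_le_mul_of_nonneg_left hb hX
  linarith

/-- Powers of `ε` are negligible compared with powers of the radius. -/
theorem const_mul_rpow_le_radius {q K c γ : ℝ} (hq : 1 / 2 < q) (hK : 0 < K) (hc : 0 < c)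
    (hγ : 0 < γ) {R : ℝ → ℝ} (hR0 : ∀ᶠ ε : ℝ in 𝓝[>] 0, 0 < R ε)
    (hRK : ∀ᶠ ε : ℝ in 𝓝[>] 0, R ε ≤ K * Real.log (1 / ε)) :
    ∀ᶠ ε : ℝ in 𝓝[>] 0, c * ε ^ γ ≤ R ε ^ (-q + 1 / 2) := by
  filter_upwards [hR0, hRK, tendsto_log_inv.eventually_gt_atTop 0, self_mem_nhdsWithin,
    tendsto_log_inv.eventually
      (eventually_log_add_le (q - 1 / 2) (Real.log c + (q - 1 / 2) * Real.log K) hγ)]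
    with ε h1 h2 h3 h4 h5
  have hε : 0 < ε := h4
  set l := Real.log (1 / ε) with hl
  have hlε : Real.log ε = -l := by rw [hl, one_div, Real.log_inv, neg_neg]
  calc c * ε ^ γ = Real.exp (Real.log c - γ * l) := by
        rw [Real.exp_sub, Real.exp_log hc, Real.rpow_def_of_pos hε, hlε, neg_mul, Real.exp_neg,
          mul_comm l, div_eq_mul_inv]
    _ ≤ Real.exp (Real.log (K * l) * (-q + 1 / 2)) := by
        rw [Real.exp_le_exp, Real.log_mul hK.ne' h3.ne']
        linarith
    _ = (K * l) ^ (-q + 1 / 2) := (Real.rpow_def_of_pos (by positivity) _).symm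
    _ ≤ R ε ^ (-q + 1 / 2) := Real.rpow_le_rpow_of_nonpos h1 h2 (by linarith)

theorem C1_div_C2_pos (φ₀ : ℝ → ℂ) (g₀ : L2) : 0 < C1 φ₀ g₀ / C2 g₀ := by
  unfold C1 C2
  positivity

theorem delta_pos (φ₀ : ℝ → ℂ) (g₀ : L2) (β : ℝ) {ε : ℝ} (hε : 0 < ε) :
    0 < delta φ₀ g₀ β ε := by
  unfold delta
  exact mul_pos (Real.rpow_pos_of_pos (C1_div_C2_pos φ₀ g₀) _) (Real.rpow_pos_of_pos hε _)

/-- The regularisation bias away from the exceptional set. It and the noise term in `div_sqrt_delta`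
carry positive powers of `ε` because β < 1. -/
theorem delta_div_sq (φ₀ : ℝ → ℂ) (g₀ : L2) (β : ℝ) {ε : ℝ} (hε : 0 < ε) :
    delta φ₀ g₀ β ε / (ε ^ β / 2) ^ 2 =
      4 * (C1 φ₀ g₀ / C2 g₀) ^ (1 / 4 : ℝ) * ε ^ ((1 - β) / 2) := by
  have h1 : ε ^ ((1 + 3 * β) / 2) = ε ^ ((1 - β) / 2) * (ε ^ β) ^ 2 := by
    rw [← Real.rpow_two, ← Real.rpow_mul hε.le, ← Real.rpow_add hε]
    ring_nf
  have h2 : 0 < ε ^ β := Real.rpow_pos_of_pos hε _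
  rw [delta, h1]
  field_simp
  ring

theorem div_sqrt_delta (φ₀ : ℝ → ℂ) (g₀ : L2) (β : ℝ) {ε : ℝ} (hε : 0 < ε) :
    ε / (2 * √(delta φ₀ g₀ β ε)) =
      (2 * √((C1 φ₀ g₀ / C2 g₀) ^ (1 / 4 : ℝ)))⁻¹ * ε ^ (3 * (1 - β) / 4) := by
  have hD := Real.rpow_pos_of_pos (C1_div_C2_pos φ₀ g₀) (1 / 4)
  have h1 : √(ε ^ ((1 + 3 * β) / 2)) = ε ^ ((1 + 3 * β) / 4) := by
    rw [Real.sqrt_eq_rpow, ← Real.rpow_mul hε.le]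
    ring_nf
  have h2 : ε = ε ^ (3 * (1 - β) / 4) * ε ^ ((1 + 3 * β) / 4) := by
    rw [← Real.rpow_add hε]
    ring_nf
    rw [Real.rpow_one]
  have h3 : 0 < ε ^ ((1 + 3 * β) / 4) := Real.rpow_pos_of_pos hε _
  have h4 : 0 < √((C1 φ₀ g₀ / C2 g₀) ^ (1 / 4 : ℝ)) := Real.sqrt_pos.2 hD
  rw [delta, Real.sqrt_mul hD.le, h1]
  set X := ε ^ ((1 + 3 * β) / 4) with hX
  rw [eq_comm, inv_mul_eq_div, div_eq_div_iff (by positivity) (by positivity)]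
  nth_rewrite 2 [h2]
  ring

theorem norm_hat_sub_hat_le {φ ψ : ℝ → ℂ} (hφ : Integrable φ volume) (hψ : Integrable ψ volume)
    (x : ℝ) : ‖hat φ x - hat ψ x‖ ≤ norm1 (φ - ψ) := by
  have hint : ∀ {χ : ℝ → ℂ}, Integrable χ volume →
      Integrable (fun t : ℝ => Complex.exp (-(Complex.I * x * t)) * χ t) volume := by
    intro χ hχ
    refine hχ.bdd_mul (c := 1) (Continuous.aestronglyMeasurable (by fun_prop)) ?_
    refine Eventually.of_forall fun t => ?_
    rw [Complex.norm_exp]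
    simp
  have : hat φ x - hat ψ x = hat (φ - ψ) x := by
    unfold hat
    rw [← integral_sub (hint hφ) (hint hψ)]
    simp only [Pi.sub_apply, mul_sub]
  rw [this]
  exact norm_hat_le _ _

/-- The error estimate for given `ε` and `R`, provided the set of small values of the truncated
transform is small. -/
theorem norm_sub_tikhonov_solution_le {φ₀ φ : ℝ → ℂ} (hφ₀ : Integrable φ₀ volume)
    (hφ : Integrable φ volume) {f₀ g₀ f g : L2} {C q R s β ε δ : ℝ} (hq : 1 / 2 < q) (hR : 0 < R)
    (hδ : 0 < δ) (hε : 0 < ε) (hεβ : 2 * ε ≤ ε ^ β) (hsol : IsSolution φ₀ f₀ g₀)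
    (hdecay : ∀ᵐ x : ℝ, ‖hat2 f₀ x‖ ^ 2 ≤ C * (1 + x ^ 2) ^ (-q))
    (htrunc : ∀ x : ℝ, ‖hat φ₀ x - truncHat φ₀ s x‖ ≤ ε)
    (hvol : volume {x : ℝ | |x| ≤ R ∧ ‖truncHat φ₀ s x‖ ≤ ε ^ β + ε} ≤
      ENNReal.ofReal (R ^ (1 - 2 * q)))
    (hφε : norm1 (φ₀ - φ) ≤ ε) (hgε : ‖g₀ - g‖ ≤ ε) (hf : IsTikhonov δ φ g f) :
    ‖f₀ - f‖ ≤ √(|C| * (2 / (2 * q - 1) + 1)) * R ^ (-q + 1 / 2) +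
      ((δ / (ε ^ β / 2) ^ 2 + ε / (2 * √δ)) * ‖f₀‖ + ε / (2 * √δ)) := by
  set E : Set ℝ := {x : ℝ | |x| ≤ R ∧ ‖truncHat φ₀ s x‖ ≤ ε ^ β + ε} with hE
  have hpi : (2 * Real.pi) ≠ 0 := by positivity
  have hs : 0 < √δ := Real.sqrt_pos.2 hδ
  have hpos : 0 < ε ^ β := Real.rpow_pos_of_pos hε _
  have hEm : MeasurableSet E := by
    have hc : Continuous (truncHat φ₀ s) := (differentiable_truncHat hφ₀ s).continuous
    have h1 : IsClosed {x : ℝ | |x| ≤ R} := isClosed_le continuous_abs continuous_const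
    have h2 : IsClosed {x : ℝ | ‖truncHat φ₀ s x‖ ≤ ε ^ β + ε} :=
      isClosed_le (hc.comp Complex.continuous_ofReal).norm continuous_const
    exact (h1.inter h2).measurableSet
  set S : Set ℝ := (fun y : ℝ => 2 * Real.pi * y) ⁻¹' ({x : ℝ | R < |x|} ∪ E) with hS
  have hSm : MeasurableSet S :=
    measurable_const_mul _
      ((measurableSet_lt measurable_const measurable_id.abs).union hEm)
  have hu : ∀ᵐ y : ℝ, ‖(𝓕 f₀ : L2) y‖ ^ 2 ≤ C * (1 + (2 * Real.pi * y) ^ 2) ^ (-q) := by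
    filter_upwards [ae_comp_mul_left hpi hdecay] with y hy
    rwa [hat2_two_pi_mul] at hy
  have hind := eLpNorm_indicator_le hq hR hu hEm hvol
  have hpoint : ∀ᵐ y : ℝ, ‖(𝓕 f₀ : L2) y - (𝓕 f : L2) y‖ ≤ ‖S.indicator (𝓕 f₀ : L2) y‖ +
      ((δ / (ε ^ β / 2) ^ 2 + ε / (2 * √δ)) * ‖(𝓕 f₀ : L2) y‖ +
        1 / (2 * √δ) * ‖(𝓕 g - 𝓕 g₀ : L2) y‖) := by
    filter_upwards [fourier_solution hφ₀ hsol, ae_comp_mul_left hpi hf,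
      Lp.coeFn_sub (𝓕 g : L2) (𝓕 g₀ : L2)] with y h1 h2 h3
    rw [hat2_two_pi_mul, hat2_two_pi_mul] at h2
    rw [h2, h3, Pi.sub_apply, h1]
    set x := 2 * Real.pi * y with hx
    set u := (𝓕 f₀ : L2) y with hu_def
    set b := hat φ x with hb
    have hab : ‖hat φ₀ x - b‖ ≤ ε := (norm_hat_sub_hat_le hφ₀ hφ x).trans hφε
    refine (norm_sub_tikhonov_le hδ hab).trans ?_
    have hfirst : δ / (δ + ‖b‖ ^ 2) * ‖u‖ ≤
        ‖S.indicator (𝓕 f₀ : L2) y‖ + δ / (ε ^ β / 2) ^ 2 * ‖u‖ := by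
      by_cases hy : y ∈ S
      · rw [Set.indicator_of_mem hy]
        have h4 : δ / (δ + ‖b‖ ^ 2) * ‖u‖ ≤ 1 * ‖u‖ := by
          gcongr
          exact (div_le_one (by positivity)).2 (by linarith [sq_nonneg ‖b‖])
        have h5 : 0 ≤ δ / (ε ^ β / 2) ^ 2 * ‖u‖ := by positivity
        linarith
      · rw [Set.indicator_of_notMem hy, norm_zero, zero_add]
        have hxE : x ∉ {x : ℝ | R < |x|} ∪ E := hy
        rw [Set.mem_union, not_or] at hxE
        have hxR : |x| ≤ R := not_lt.1 hxE.1
        have hlarge : ε ^ β + ε < ‖truncHat φ₀ s x‖ := by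
          by_contra! h
          exact hxE.2 ⟨hxR, h⟩
        have h4 := norm_le_norm_add_norm_sub' (truncHat φ₀ s x) (hat φ₀ x)
        have h5 := norm_le_norm_add_norm_sub' (hat φ₀ x) b
        have h6 := htrunc x
        rw [norm_sub_rev] at h6
        -- From the level ε^β + ε one `ε` is lost to truncation and one to the perturbation of the
        -- kernel; the remaining ε^β - ε is at least ε^β/2.
        have hbl : ε ^ β / 2 ≤ ‖b‖ := by linarith
        gcongr
        nlinarith
    have hrest : (ε * ‖u‖ + ‖(𝓕 g : L2) y - hat φ₀ x * u‖) / (2 * √δ) =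
        ε / (2 * √δ) * ‖u‖ + 1 / (2 * √δ) * ‖(𝓕 g : L2) y - hat φ₀ x * u‖ := by ring
    rw [hrest]
    linarith
  have hmain := norm_sub_le_of_pointwise hSm (by positivity) (by positivity) (by positivity)
    hind hpoint
  have hsub : ∀ a b : L2, ‖(𝓕 a - 𝓕 b : L2)‖ = ‖a - b‖ := by
    intro a b
    rw [← Lp.norm_fourier_eq (a - b)]
    congr 1
    exact ((Lp.fourierTransformₗᵢ ℝ ℂ).map_sub a b).symm
  rw [hsub, hsub, Lp.norm_fourier_eq, norm_sub_rev g] at hmain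
  refine hmain.trans ?_
  have : 1 / (2 * √δ) * ‖g₀ - g‖ ≤ 1 / (2 * √δ) * ε := by gcongr
  have h7 : 1 / (2 * √δ) * ε = ε / (2 * √δ) := by ring
  linarith

theorem exists_error_bound {β q C : ℝ} (hβ₀ : 0 < β) (hβ₁ : β < 1 / 3) (hq : 1 / 2 < q)
    {φ₀ : ℝ → ℂ} (hφ₀ : Integrable φ₀ volume) (hne : ¬ φ₀ =ᵐ[volume] 0) {f₀ g₀ : L2}
    (hsol : IsSolution φ₀ f₀ g₀)
    (hdecay : ∀ᵐ x : ℝ, ‖hat2 f₀ x‖ ^ 2 ≤ C * (1 + x ^ 2) ^ (-q))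
    (hp : Tendsto (fun s : ℝ => p φ₀ s / (s : EReal)) atTop (𝓝 ⊤)) {R : ℝ → ℝ}
    (hR : ∀ᶠ ε : ℝ in 𝓝[>] 0, IsRadius φ₀ q β ε (R ε)) :
    ∃ C₃ : ℝ, 0 < C₃ ∧ ∀ᶠ ε : ℝ in 𝓝[>] 0, ∀ (φ : ℝ → ℂ) (g f : L2), Integrable φ volume →
      norm1 (φ₀ - φ) ≤ ε → ‖g₀ - g‖ ≤ ε → IsTikhonov (delta φ₀ g₀ β ε) φ g f →
      ‖f₀ - f‖ ≤ C₃ * (R ε) ^ (-q + 1 / 2) := by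
  obtain ⟨s₁, hs₁, hcut⟩ := exists_le_cutoff hφ₀ hne hp
  obtain ⟨K, hK, hRK⟩ := radius_le_log hq hβ₀ hβ₁ hφ₀ hne hp hR
  obtain ⟨x₀, hx₀⟩ := exists_hat_ne_zero hφ₀ hne
  have hRtop := tendsto_radius hq hβ₀ hβ₁ hφ₀ hne hp hR
  -- Half of |φ̂₀(x₀)| survives truncation as soon as ε is below the other half, giving a lower
  -- bound independent of `ε`.
  have ha : 0 < ‖hat φ₀ x₀‖ / 2 := by positivity
  have hR0 : ∀ᶠ ε : ℝ in 𝓝[>] 0, 0 < R ε := hRtop.eventually_gt_atTop 0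
  have hD : 0 < (C1 φ₀ g₀ / C2 g₀) ^ (1 / 4 : ℝ) :=
    Real.rpow_pos_of_pos (C1_div_C2_pos φ₀ g₀) _
  have hD' : 0 < √((C1 φ₀ g₀ / C2 g₀) ^ (1 / 4 : ℝ)) := Real.sqrt_pos.2 hD
  have hεβ : ∀ᶠ ε : ℝ in 𝓝[>] 0, 2 * ε ^ (1 - β) ≤ 1 := by
    have h1 : Tendsto (fun ε : ℝ => 2 * ε ^ (1 - β)) (𝓝 0) (𝓝 (2 * 0 ^ (1 - β))) :=
      (Real.continuousAt_rpow_const 0 (1 - β) (Or.inr (by linarith))).tendsto.const_mul 2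
    rw [Real.zero_rpow (by linarith), mul_zero] at h1
    filter_upwards [(h1.mono_left nhdsWithin_le_nhds).eventually (gt_mem_nhds one_pos)] with ε h
    exact h.le
  -- The root comes from the exceptional set; 2‖f₀‖ from bias and kernel noise, 1 from data noise,
  -- each of these powers of `ε` being at most R_ε^(-q+1/2).
  refine ⟨√(|C| * (2 / (2 * q - 1) + 1)) + 2 * ‖f₀‖ + 1, by positivity, ?_⟩
  filter_upwards [hR, hcut, hR0, hεβ, self_mem_nhdsWithin,
    hRtop.eventually (volume_small_set_le hφ₀ hq hs₁ ha x₀), Ioo_mem_nhdsGT ha,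
    const_mul_rpow_le_radius hq hK (show 0 < 4 * (C1 φ₀ g₀ / C2 g₀) ^ (1 / 4 : ℝ) by positivity)
      (show 0 < (1 - β) / 2 by linarith) hR0 hRK,
    const_mul_rpow_le_radius hq hK
      (show 0 < (2 * √((C1 φ₀ g₀ / C2 g₀) ^ (1 / 4 : ℝ)))⁻¹ by positivity)
      (show 0 < 3 * (1 - β) / 4 by linarith) hR0 hRK]
    with ε h1 h2 h3 h4 h5 h6 h7 h8 h9 φ g f hφ hφε hgε hf
  have hε : 0 < ε := h5
  have hpos : 0 < ε ^ β := Real.rpow_pos_of_pos hε _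
  have h2ε : 2 * ε ≤ ε ^ β := by
    have h10 : ε = ε ^ (1 - β) * ε ^ β := by
      rw [← Real.rpow_add hε, sub_add_cancel, Real.rpow_one]
    calc 2 * ε = 2 * ε ^ (1 - β) * ε ^ β := by rw [mul_assoc, ← h10]
      _ ≤ 1 * ε ^ β := by gcongr
      _ = _ := one_mul _
  have htrunc : ∀ x : ℝ, ‖hat φ₀ x - truncHat φ₀ (cutoff φ₀ ε) x‖ ≤ ε := fun x =>
    (norm_hat_sub_truncHat_le hφ₀ _ x).trans (setIntegral_compl_cutoff_le hφ₀ hp hε)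
  have hlow : ‖hat φ₀ x₀‖ / 2 ≤ ‖truncHat φ₀ (cutoff φ₀ ε) x₀‖ := by
    have h10 := norm_le_norm_add_norm_sub' (hat φ₀ x₀) (truncHat φ₀ (cutoff φ₀ ε) x₀)
    linarith [htrunc x₀, h7.2]
  -- The radius equation enters here: exponentiated, it identifies the threshold ε^β + ε with the
  -- one for which the exceptional set is small.
  have hvol := h6 (cutoff φ₀ ε) h2 hlow (ε ^ β + ε) (by
    rw [h1.2.2, neg_neg, Real.exp_log (by positivity)])
  have hmain := norm_sub_tikhonov_solution_le hφ₀ hφ hq h3 (delta_pos φ₀ g₀ β hε) hε h2ε hsol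
    hdecay htrunc hvol hφε hgε hf
  rw [delta_div_sq φ₀ g₀ β hε, div_sqrt_delta φ₀ g₀ β hε] at hmain
  refine hmain.trans ?_
  set r := R ε ^ (-q + 1 / 2) with hr
  have h11 := mul_le_mul_of_nonneg_right (add_le_add h8 h9) (norm_nonneg f₀)
  linarith

end Deconvolution

theorem theorem2
    (β q C : ℝ) (hβ₀ : 0 < β) (hβ₁ : β < 1 / 3) (hq : 1 / 2 < q)
    (φ₀ : ℝ → ℂ) (hφ₀ : Integrable φ₀ volume) (hφ₀_ne : ¬ φ₀ =ᵐ[volume] 0)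
    (f₀ g₀ : Deconvolution.L2)
    (hsol : Deconvolution.IsSolution φ₀ f₀ g₀)
    (hdecay : ∀ᵐ x : ℝ, ‖Deconvolution.hat2 f₀ x‖ ^ 2 ≤ C * (1 + x ^ 2) ^ (-q))
    (hp : Tendsto (fun s : ℝ => Deconvolution.p φ₀ s / (s : EReal)) atTop (𝓝 ⊤)) :
    -- for small `ε` the equation for `R_ε` has a solution, and only one
    (∀ᶠ ε : ℝ in 𝓝[>] 0, ∃! R : ℝ, Deconvolution.IsRadius φ₀ q β ε R) ∧
    ∀ R : ℝ → ℝ, (∀ᶠ ε : ℝ in 𝓝[>] 0, Deconvolution.IsRadius φ₀ q β ε (R ε)) →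
      Tendsto R (𝓝[>] 0) atTop ∧
      (∃ C₃ : ℝ, 0 < C₃ ∧ ∀ᶠ ε : ℝ in 𝓝[>] 0,
        ∀ (φ : ℝ → ℂ) (g f : Deconvolution.L2), Integrable φ volume →
          Deconvolution.norm1 (φ₀ - φ) ≤ ε → ‖g₀ - g‖ ≤ ε →
          Deconvolution.IsTikhonov (Deconvolution.delta φ₀ g₀ β ε) φ g f →
          ‖f₀ - f‖ ≤ C₃ * (R ε) ^ (-q + 1 / 2)) ∧
      (Deconvolution.HasCompactSupp φ₀ →
        (∃ M : ℝ, ∀ᶠ ε : ℝ in 𝓝[>] 0, |Deconvolution.cutoff φ₀ ε| ≤ M) ∧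
        Tendsto (fun ε : ℝ => Real.log (R ε) / Real.log (Real.log (1 / ε))) (𝓝[>] 0) (𝓝 1)) := by
  refine ⟨Deconvolution.existsUnique_radius hq hβ₀ hβ₁ hφ₀ hφ₀_ne hp, fun R hR => ⟨?_, ?_, ?_⟩⟩
  · exact Deconvolution.tendsto_radius hq hβ₀ hβ₁ hφ₀ hφ₀_ne hp hR
  · exact Deconvolution.exists_error_bound hβ₀ hβ₁ hq hφ₀ hφ₀_ne hsol hdecay hp hR
  · intro hcomp
    obtain ⟨M, hM⟩ := Deconvolution.cutoff_le_of_compact hcomp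
    obtain ⟨s₁, hs₁, hcut⟩ := Deconvolution.exists_le_cutoff hφ₀ hφ₀_ne hp
    refine ⟨⟨M, ?_⟩, Deconvolution.tendsto_log_radius_div hq hβ₀ hβ₁ hφ₀ hφ₀_ne hp hR hM⟩
    filter_upwards [hcut] with ε hε
    rw [abs_of_pos (hs₁.trans_le hε)]
    exact hM ε
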